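/- Let $G\subset\mathbb{R}^2$ be a bounded open set, let $g_0$ be the standard flat metric of $\mathbb{R}^2$, and let $u:\overline{G}\to\mathbb{R}$ be a smooth function with $u\ge 0$ and $u|_{\partial G}\equiv 0$. Put $g=e^{2u}g_0$, let $K_g$ be the Gaussian curvature of $g$, let $\mu_0:=\operatorname{area}(G,g)$, and for $0\le A\le\mu_0$ let $$k(A):=\sup\Bigl\{\int_{\widehat G}K_g\,\mathrm{darea}_g\;\Bigm|\;\widehat G\subset G\text{ open},\ \operatorname{area}(\widehat G,g)=A\Bigr\}.$$ Suppose that there are $\kappa\in(0,2\pi)$, $C>0$, $r\in(0,1]$ and $\mu_1\in(0,\mu_0]$ such that $$k(A)\le C A^r\le\kappa\quad\text{for }0\le A\le\mu_1,\qquad k(A)\le\kappa\quad\text{for }\mu_1\le A\le\mu_0.$$ Then $$\max_{\overline G}u\le\frac12\left|\log\left(1-\frac{\kappa}{2\pi}\right)\right|+\frac{\kappa}{4\pi-2\kappa}\,\log\left(\frac{\mu_0}{r^{1/r}\,\mu_1}\right).$$ -/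

import Mathlib

open Real MeasureTheory
open scoped ContDiff

noncomputable section

/-- The Euclidean plane. -/
abbrev Plane : Type := EuclideanSpace ℝ (Fin 2)

/-- The coefficient matrix of a metric tensor on (a region of) the plane in the standard
coordinates: `g x i j` is the value of `g_{ij}` at `x`. -/
abbrev MetricField : Type := Plane → Matrix (Fin 2) (Fin 2) ℝ

namespace MetricField

/-- The partial derivative of `f` in the `i`-th coordinate direction. -/
def partialDeriv (i : Fin 2) (f : Plane → ℝ) (x : Plane) : ℝ :=
  fderiv ℝ f x (EuclideanSpace.single i 1)

/-- The Christoffel symbol `Γ^k_{ij}` of the Levi-Civita connection of `g`. -/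
def christoffel (g : MetricField) (k i j : Fin 2) (x : Plane) : ℝ :=
  (1 / 2) * ∑ l, (g x)⁻¹ k l *
    (partialDeriv i (fun y => g y j l) x + partialDeriv j (fun y => g y i l) x
      - partialDeriv l (fun y => g y i j) x)

/-- The component along `∂_l` of `R(∂_i, ∂_j) ∂_k`, where
`R(X, Y) Z = ∇_X ∇_Y Z - ∇_Y ∇_X Z - ∇_{[X, Y]} Z`. -/
def riemannTensor (g : MetricField) (l k i j : Fin 2) (x : Plane) : ℝ :=
  partialDeriv i (g.christoffel l j k) x - partialDeriv j (g.christoffel l i k) x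
    + ∑ m, (g.christoffel l i m x * g.christoffel m j k x
      - g.christoffel l j m x * g.christoffel m i k x)

/-- The Gaussian curvature `g(R(∂_0, ∂_1) ∂_1, ∂_0) / det g`. -/
def gaussCurvature (g : MetricField) (x : Plane) : ℝ :=
  (∑ l, g x l 0 * g.riemannTensor l 1 0 1 x) / (g x).det

/-- The area of `S` with respect to `g`. -/
def area (g : MetricField) (S : Set Plane) : ℝ :=
  ∫ x in S, √(g x).det

/-- The integral of the Gaussian curvature over `S` with respect to the area element of `g`. -/
def curvatureIntegral (g : MetricField) (S : Set Plane) : ℝ :=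
  ∫ x in S, g.gaussCurvature x * √(g x).det

/-- The supremum, taken in the extended reals, of the curvature integrals over all open subsets
of `G` whose area with respect to `g` is `A`. -/
def supCurvatureIntegral (g : MetricField) (G : Set Plane) (A : ℝ) : EReal :=
  sSup {t : EReal | ∃ U : Set Plane, IsOpen U ∧ U ⊆ G ∧ g.area U = A ∧
    t = ((g.curvatureIntegral U : ℝ) : EReal)}

/-- The metric `e^{2u} g₀`, where `g₀` is the standard flat metric of the plane. -/
def conformal (u : Plane → ℝ) : MetricField :=
  fun x => Real.exp (2 * u x) • (1 : Matrix (Fin 2) (Fin 2) ℝ)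

end MetricField

end

/-!
On a superlevel set `{u > t}`, `t > 0`, which is relatively compact in `G`, the curvature equation
`K dA = -Δu dx` (`MetricField.gaussCurvature_conformal_mul`) turns the curvature integral into the
flux of `∇u` through the level `{u = t}`. Let `V(t)` and `A(t)` be the areas of `{u > t}` with
respect to `g₀` and `g = e^{2u} g₀`. The isoperimetric inequality and Cauchy–Schwarz give
`4π V ≤ -V' k(A)`.

This is proved in the integrated form
`4π (t - s) V(t) ≤ (V(s) - V(t)) · sup_{s < τ < t} ∫_{u > τ} K dA` (`four_pi_mul_sub_mul_le`),
which needs neither the coarea formula nor Sard's theorem: one tests `-Δu` with a function of `u`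
that increases between the levels `s` and `t`, and uses the sharp Sobolev inequality
`two_sqrt_pi_mul_le_integral_norm_fderiv`. The latter follows from the Brunn–Minkowski inequality
`|E + B_ε| ≥ |E| + 2 ε √(π |E|) + π ε²`, integrated over the superlevel sets of a function.

Write `k ≤ K` with the nondecreasing majorant `K(a) = C a ^ r` for `a ≤ m = r ^ (1 / r) μ₁` and
`K(a) = κ` for `a > m`. Since `dA = e^{2t} dV`, the quantity `B = e^{2t} V` satisfies
`dB = 2 B dt + dA`, and inserting `4π B dt ≤ -K(A) dA` shows that `B ≥ Φ(A)`, where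
`Φ' = 1 - K / 2π`, `Φ(0) = 0` (`IsLevelAreaPair.le_exp_mul`). Hence `dt ≤ -K(A) / (4π Φ(A)) dA`, and
the maximum of `u` is at most `H(μ₀)`, where `H' = K / (4π Φ)`, `H(0) = 0`
(`IsLevelAreaPair.sub_le_of_hasDerivWithinAt`). Since `A` and `V` may jump, at levels of positive
area, these differential inequalities are integrated by `le_of_eventually_le_add_mul`. The part of `H`
below `m` is at most `|log (1 - κ / 2π)| / 2` by Bernoulli's inequality
(`heightBound_le_of_le`), and the part above `m` is the logarithmic term.
-/

open Set Filter Topology Pointwise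
open MetricField (partialDeriv)

/-! ### The Brunn–Minkowski inequality in the plane -/

/-- One-dimensional Brunn–Minkowski for compact sets: after translating so that the maximum of
`K` and the minimum of `L` are `0`, both sets lie in `K + L` and they meet in a single point. -/
theorem volume_add_volume_le_volume_add_of_isCompact {K L : Set ℝ} (hK : IsCompact K)
    (hL : IsCompact L) (hKn : K.Nonempty) (hLn : L.Nonempty) :
    volume K + volume L ≤ volume (K + L) := by
  obtain ⟨a, haK, ha⟩ := hK.exists_isGreatest hKn
  obtain ⟨b, hbL, hb⟩ := hL.exists_isLeast hLn
  have h1 : volume ((fun x => x + b) '' K) = volume K := by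
    rw [Set.image_add_right, measure_preimage_add_right]
  have h2 : volume ((fun x => a + x) '' L) = volume L := by
    rw [Set.image_add_left, measure_preimage_add]
  have hm : MeasurableSet ((fun x => a + x) '' L) :=
    (hL.image (by fun_prop)).measurableSet
  have hd : AEDisjoint volume ((fun x => x + b) '' K) ((fun x => a + x) '' L) := by
    refine measure_mono_null (t := {a + b}) ?_ (by simp)
    rintro _ ⟨⟨x, hx, rfl⟩, ⟨y, hy, hxy⟩⟩
    have := ha hx
    have := hb hy
    simp only [mem_singleton_iff] at *
    linarith
  rw [← h1, ← h2, ← measure_union₀ hm.nullMeasurableSet hd]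
  refine measure_mono (union_subset ?_ ?_)
  · rintro _ ⟨x, hx, rfl⟩
    exact add_mem_add hx hbL
  · rintro _ ⟨x, hx, rfl⟩
    exact add_mem_add haK hx

/-- One-dimensional Brunn–Minkowski inequality. -/
theorem volume_add_volume_le_volume_add {A B : Set ℝ} (hA : MeasurableSet A)
    (hB : MeasurableSet B) (hAn : A.Nonempty) (hBn : B.Nonempty) :
    volume A + volume B ≤ volume (A + B) := by
  obtain ⟨a, ha⟩ := hAn
  obtain ⟨b, hb⟩ := hBn
  have key : ∀ K ⊆ A, IsCompact K → ∀ L ⊆ B, IsCompact L →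
      volume K + volume L ≤ volume (A + B) := by
    intro K hKA hK L hLB hL
    calc volume K + volume L ≤ volume (insert a K) + volume (insert b L) := by
          gcongr <;> exact subset_insert _ _
      _ ≤ volume (insert a K + insert b L) :=
          volume_add_volume_le_volume_add_of_isCompact (hK.insert a) (hL.insert b)
            (insert_nonempty _ _) (insert_nonempty _ _)
      _ ≤ volume (A + B) :=
          measure_mono (add_subset_add (insert_subset ha hKA) (insert_subset hb hLB))
  rw [hA.measure_eq_iSup_isCompact, hB.measure_eq_iSup_isCompact]
  simp only [iSup_and']
  exact ENNReal.biSup_add_biSup_le' ⟨∅, by simp⟩ ⟨∅, by simp⟩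
    fun K hK L hL => key K hK.1 hK.2 L hL.1 hL.2

theorem measurable_volume_real_section {E : Set (ℝ × ℝ)} (hE : MeasurableSet E) :
    Measurable fun x => volume.real (Prod.mk x ⁻¹' E) :=
  (measurable_measure_prodMk_left hE).ennreal_toReal

theorem exists_volume_section_le {E : Set (ℝ × ℝ)} (hE : Bornology.IsBounded E) :
    ∃ R : ℝ, ∀ x, volume (Prod.mk x ⁻¹' E) ≤ ENNReal.ofReal R := by
  obtain ⟨R, hR⟩ := hE.subset_closedBall 0
  refine ⟨2 * R, fun x => ?_⟩
  rw [← Real.volume_closedBall (0 : ℝ)]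
  refine measure_mono fun y hy => ?_
  have := hR hy
  rw [mem_closedBall_zero_iff, Prod.norm_def] at this
  rw [mem_closedBall_zero_iff]
  exact (le_max_right _ _).trans this

theorem ofReal_volume_real_section {E : Set (ℝ × ℝ)} (hE : Bornology.IsBounded E) (x : ℝ) :
    ENNReal.ofReal (volume.real (Prod.mk x ⁻¹' E)) = volume (Prod.mk x ⁻¹' E) := by
  obtain ⟨R, hR⟩ := exists_volume_section_le hE
  exact ofReal_measureReal ((hR x).trans_lt ENNReal.ofReal_lt_top).ne

theorem bddAbove_volume_real_section {E : Set (ℝ × ℝ)} (hE : Bornology.IsBounded E) :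
    BddAbove (range fun x => volume.real (Prod.mk x ⁻¹' E)) := by
  obtain ⟨R, hR⟩ := exists_volume_section_le hE
  refine ⟨max R 0, ?_⟩
  rintro _ ⟨x, rfl⟩
  refine ENNReal.toReal_le_of_le_ofReal (le_max_right _ _) ((hR x).trans ?_)
  exact ENNReal.ofReal_le_ofReal (le_max_left _ _)

theorem volume_prod_eq_lintegral_section {E : Set (ℝ × ℝ)} (hE : MeasurableSet E)
    (hb : Bornology.IsBounded E) :
    volume E = ∫⁻ x, ENNReal.ofReal (volume.real (Prod.mk x ⁻¹' E)) := by
  simp_rw [ofReal_volume_real_section hb]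
  exact Measure.prod_apply hE

theorem iSup_volume_real_section_pos {E : Set (ℝ × ℝ)} (hE : IsOpen E)
    (hb : Bornology.IsBounded E) (hn : E.Nonempty) :
    0 < ⨆ x, volume.real (Prod.mk x ⁻¹' E) := by
  obtain ⟨⟨x, y⟩, h⟩ := hn
  refine lt_of_lt_of_le ?_ (le_ciSup (bddAbove_volume_real_section hb) x)
  have ho : IsOpen (Prod.mk x ⁻¹' E) := hE.preimage (by fun_prop)
  have hpos := ho.measure_pos volume ⟨y, h⟩
  rw [← ofReal_volume_real_section hb] at hpos
  exact ENNReal.ofReal_pos.mp hpos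

/-- Sections of a sumset contain sums of sections, so the one-dimensional inequality applies
to them. -/
theorem volume_real_section_add_le {E D : Set (ℝ × ℝ)} (hE : IsOpen E) (hD : IsOpen D)
    (hEb : Bornology.IsBounded E) (hDb : Bornology.IsBounded D) {x y : ℝ}
    (hx : 0 < volume.real (Prod.mk x ⁻¹' E)) (hy : 0 < volume.real (Prod.mk y ⁻¹' D)) :
    volume.real (Prod.mk x ⁻¹' E) + volume.real (Prod.mk y ⁻¹' D) ≤
      volume.real (Prod.mk (x + y) ⁻¹' (E + D)) := by
  have hn : ∀ s : Set ℝ, 0 < volume.real s → s.Nonempty := by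
    intro s hs
    rw [nonempty_iff_ne_empty]
    rintro rfl
    simp at hs
  have h := volume_add_volume_le_volume_add
    (hE.preimage (f := Prod.mk x) (by fun_prop)).measurableSet
    (hD.preimage (f := Prod.mk y) (by fun_prop)).measurableSet (hn _ hx) (hn _ hy)
  have hsub : Prod.mk x ⁻¹' E + Prod.mk y ⁻¹' D ⊆ Prod.mk (x + y) ⁻¹' (E + D) := by
    rintro _ ⟨p, hp, q, hq, rfl⟩
    exact ⟨(x, p), hp, (y, q), hq, rfl⟩
  have h' := h.trans (measure_mono hsub)
  rw [← ofReal_volume_real_section hEb, ← ofReal_volume_real_section hDb,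
    ← ofReal_volume_real_section (hEb.add hDb), ← ENNReal.ofReal_add hx.le hy.le] at h'
  exact (ENNReal.ofReal_le_ofReal_iff measureReal_nonneg).mp h'

/-- The layer-cake step: with section lengths normalised to have supremum `1`, each superlevel
set for the sumset contains the sum of the corresponding superlevel sets. -/
theorem lintegral_section_div_add_le {E D : Set (ℝ × ℝ)} (hE : IsOpen E) (hD : IsOpen D)
    (hEb : Bornology.IsBounded E) (hDb : Bornology.IsBounded D) {α β : ℝ} (hα : 0 < α)
    (hβ : 0 < β) (hαE : α = ⨆ x, volume.real (Prod.mk x ⁻¹' E))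
    (hβD : β = ⨆ x, volume.real (Prod.mk x ⁻¹' D)) :
    (∫⁻ x, ENNReal.ofReal (volume.real (Prod.mk x ⁻¹' E) / α)) +
      (∫⁻ x, ENNReal.ofReal (volume.real (Prod.mk x ⁻¹' D) / β)) ≤
      ∫⁻ x, ENNReal.ofReal (volume.real (Prod.mk x ⁻¹' (E + D)) / (α + β)) := by
  have hS : IsOpen (E + D) := hE.add_right
  have mE := measurable_volume_real_section hE.measurableSet
  have mD := measurable_volume_real_section hD.measurableSet
  have mS := measurable_volume_real_section hS.measurableSet
  have lc : ∀ (f : ℝ → ℝ) (c : ℝ), Measurable f → (∀ x, 0 ≤ f x) → 0 < c →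
      ∫⁻ x, ENNReal.ofReal (f x / c) = ∫⁻ t in Ioi 0, volume {x | t < f x / c} := by
    intro f c hf h0 hc
    exact lintegral_eq_lintegral_meas_lt _ (ae_of_all _ fun x => div_nonneg (h0 x) hc.le)
      (hf.div_const c).aemeasurable
  have mble : ∀ (f : ℝ → ℝ), Measurable fun t : ℝ => volume {x | t < f x} := by
    intro f
    have : Antitone fun t : ℝ => volume {x | t < f x} :=
      fun s t hst => measure_mono fun x hx => lt_of_le_of_lt hst hx
    exact this.measurable
  rw [lc _ _ mE (fun _ => measureReal_nonneg) hα, lc _ _ mD (fun _ => measureReal_nonneg) hβ,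
    lc _ _ mS (fun _ => measureReal_nonneg) (add_pos hα hβ), ← lintegral_add_left (mble _)]
  refine setLIntegral_mono' measurableSet_Ioi fun t ht => ?_
  have ht0 : 0 < t := ht
  have hle : ∀ (B : Set (ℝ × ℝ)) (γ : ℝ), Bornology.IsBounded B → 0 < γ →
      γ = (⨆ x, volume.real (Prod.mk x ⁻¹' B)) → ∀ x, volume.real (Prod.mk x ⁻¹' B) / γ ≤ 1 := by
    intro B γ hB hγ hγB x
    rw [div_le_one hγ, hγB]
    exact le_ciSup (bddAbove_volume_real_section hB) x
  rcases lt_or_ge t 1 with ht1 | ht1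
  · have hne : ∀ (B : Set (ℝ × ℝ)) (γ : ℝ), 0 < γ →
        γ = (⨆ x, volume.real (Prod.mk x ⁻¹' B)) →
        {x | t < volume.real (Prod.mk x ⁻¹' B) / γ}.Nonempty := by
      intro B γ hγ hγB
      have : t * γ < ⨆ x, volume.real (Prod.mk x ⁻¹' B) := by
        rw [← hγB]
        nlinarith
      obtain ⟨x, hx⟩ := exists_lt_of_lt_ciSup this
      exact ⟨x, (lt_div_iff₀ hγ).mpr hx⟩
    refine (volume_add_volume_le_volume_add (measurableSet_lt measurable_const (mE.div_const α))
      (measurableSet_lt measurable_const (mD.div_const β)) (hne E α hα hαE)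
      (hne D β hβ hβD)).trans (measure_mono ?_)
    rintro _ ⟨x, hx, y, hy, rfl⟩
    simp only [mem_ofPred_eq] at hx hy ⊢
    rw [lt_div_iff₀ hα] at hx
    rw [lt_div_iff₀ hβ] at hy
    have := volume_real_section_add_le hE hD hEb hDb (lt_trans (by positivity) hx)
      (lt_trans (by positivity) hy)
    rw [lt_div_iff₀ (add_pos hα hβ)]
    linarith
  · have h1 : {x | t < volume.real (Prod.mk x ⁻¹' E) / α} = ∅ :=
      eq_empty_of_forall_notMem fun x hx => (ht1.trans_lt hx).not_ge (hle E α hEb hα hαE x)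
    have h2 : {x | t < volume.real (Prod.mk x ⁻¹' D) / β} = ∅ :=
      eq_empty_of_forall_notMem fun x hx => (ht1.trans_lt hx).not_ge (hle D β hDb hβ hβD x)
    rw [h1, h2]
    simp

/-- Two-dimensional Brunn–Minkowski inequality, in the expanded form of
`√|E| + √|D| ≤ √|E + D|`. -/
theorem volume_real_add_volume_real_add_le_prod {E D : Set (ℝ × ℝ)} (hE : IsOpen E)
    (hD : IsOpen D) (hEb : Bornology.IsBounded E) (hDb : Bornology.IsBounded D)
    (hEn : E.Nonempty) (hDn : D.Nonempty) :
    volume.real E + volume.real D + 2 * √(volume.real E) * √(volume.real D) ≤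
      volume.real (E + D) := by
  have hS : IsOpen (E + D) := hE.add_right
  obtain ⟨α, hαE⟩ : ∃ α, α = ⨆ x, volume.real (Prod.mk x ⁻¹' E) := ⟨_, rfl⟩
  obtain ⟨β, hβD⟩ : ∃ β, β = ⨆ x, volume.real (Prod.mk x ⁻¹' D) := ⟨_, rfl⟩
  have hα : 0 < α := hαE ▸ iSup_volume_real_section_pos hE hEb hEn
  have hβ : 0 < β := hβD ▸ iSup_volume_real_section_pos hD hDb hDn
  have key := lintegral_section_div_add_le hE hD hEb hDb hα hβ hαE hβD
  have sc : ∀ (B : Set (ℝ × ℝ)) (c : ℝ), IsOpen B → Bornology.IsBounded B → 0 < c →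
      ∫⁻ x, ENNReal.ofReal (volume.real (Prod.mk x ⁻¹' B) / c) =
        ENNReal.ofReal (volume.real B / c) := by
    intro B c hB hBb hc
    have : ∀ x, ENNReal.ofReal (volume.real (Prod.mk x ⁻¹' B) / c) =
        ENNReal.ofReal (volume.real (Prod.mk x ⁻¹' B)) * ENNReal.ofReal c⁻¹ := fun x => by
      rw [div_eq_mul_inv, ENNReal.ofReal_mul measureReal_nonneg]
    simp_rw [this]
    rw [lintegral_mul_const _ (measurable_volume_real_section hB.measurableSet).ennreal_ofReal,
      ← volume_prod_eq_lintegral_section hB.measurableSet hBb, div_eq_mul_inv,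
      ENNReal.ofReal_mul measureReal_nonneg, ofReal_measureReal hBb.measure_lt_top.ne]
  rw [sc E α hE hEb hα, sc D β hD hDb hβ, sc _ _ hS (hEb.add hDb) (add_pos hα hβ),
    ← ENNReal.ofReal_add (by positivity) (by positivity),
    ENNReal.ofReal_le_ofReal_iff (by positivity), le_div_iff₀ (add_pos hα hβ)] at key
  refine le_trans ?_ key
  set F := volume.real E
  set G := volume.real D
  have hF2 : √F ^ 2 = F := Real.sq_sqrt measureReal_nonneg
  have hG2 : √G ^ 2 = G := Real.sq_sqrt measureReal_nonneg
  have e : (F / α + G / β) * (α + β) = F + G + (β * F / α + α * G / β) := by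
    field_simp
    ring
  rw [e]
  have : 2 * √F * √G ≤ β * F / α + α * G / β := by
    rw [div_add_div _ _ hα.ne' hβ.ne', le_div_iff₀ (mul_pos hα hβ)]
    have hsq := sq_nonneg (β * √F - α * √G)
    rw [show (β * √F - α * √G) ^ 2 = β * √F ^ 2 * β + α * (α * √G ^ 2) - 2 * √F * √G * (α * β) by
      ring, hF2, hG2] at hsq
    linarith
  linarith

/-- Two-dimensional Brunn–Minkowski inequality for open subsets of the Euclidean plane. -/
theorem volume_real_add_volume_real_add_le {E D : Set Plane} (hE : IsOpen E)
    (hD : IsOpen D) (hEb : Bornology.IsBounded E) (hDb : Bornology.IsBounded D)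
    (hEn : E.Nonempty) (hDn : D.Nonempty) :
    volume.real E + volume.real D + 2 * √(volume.real E) * √(volume.real D) ≤
      volume.real (E + D) := by
  let T : Plane ≃L[ℝ] ℝ × ℝ :=
    (EuclideanSpace.equiv (Fin 2) ℝ).trans (ContinuousLinearEquiv.finTwoArrow ℝ ℝ)
  have hT : MeasurePreserving T volume volume :=
    (volume_preserving_finTwoArrow ℝ).comp
      (EuclideanSpace.volume_preserving_symm_measurableEquiv_toLp (Fin 2))
  have hv : ∀ B : Set Plane, IsOpen B → volume.real (T '' B) = volume.real B := by
    intro B hB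
    have : volume (T ⁻¹' (T '' B)) = volume (T '' B) :=
      hT.measure_preimage (T.toHomeomorph.isOpenMap B hB).measurableSet.nullMeasurableSet
    simp only [measureReal_def]
    rw [← this]
    congr 2
    exact preimage_image_eq B T.injective
  have hadd : T '' (E + D) = T '' E + T '' D := Set.image_add T
  have h := volume_real_add_volume_real_add_le_prod (T.toHomeomorph.isOpenMap E hE)
    (T.toHomeomorph.isOpenMap D hD) (T.lipschitz.isBounded_image hEb)
    (T.lipschitz.isBounded_image hDb) (hEn.image T) (hDn.image T)
  have e1 := hv E hE
  have e2 := hv D hD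
  have e3 := hv (E + D) hE.add_right
  rw [hadd] at e3
  rw [← e1, ← e2, ← e3]
  exact h

/-! ### The sharp Sobolev inequality -/

/-- The sup-convolution of `w` over balls of radius `ε` exceeds `w` by at most
`ε * (‖Dw‖ + δ)`, uniformly once `ε` is small. -/
theorem eventually_le_add_mul_norm_fderiv {w : Plane → ℝ} (hw : ContDiff ℝ 1 w)
    (hc : HasCompactSupport w) {δ : ℝ} (hδ : 0 < δ) :
    ∀ᶠ ε in 𝓝[>] (0 : ℝ), ∀ x z, dist x z < ε → w x ≤ w z + ε * (‖fderiv ℝ w z‖ + δ) := by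
  have huc : UniformContinuous (fderiv ℝ w) :=
    (hw.continuous_fderiv one_ne_zero).uniformContinuous_of_tendsto_cocompact
      (hc.fderiv ℝ).is_zero_at_infty
  obtain ⟨ε₀, hε₀, h⟩ := Metric.uniformContinuous_iff.mp huc δ hδ
  filter_upwards [Ioo_mem_nhdsGT hε₀] with ε hε x z hxz
  have hb : ∀ y ∈ Metric.ball z ε, ‖fderiv ℝ w y‖ ≤ ‖fderiv ℝ w z‖ + δ := by
    intro y hy
    have h1 := h (lt_trans (Metric.mem_ball.mp hy) hε.2)
    rw [dist_eq_norm] at h1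
    have h2 := norm_le_norm_add_norm_sub' (fderiv ℝ w y) (fderiv ℝ w z)
    linarith
  have hm := (convex_ball z ε).norm_image_sub_le_of_norm_fderiv_le
    (fun y _ => (hw.differentiable one_ne_zero) y) hb (Metric.mem_ball_self hε.1)
    (Metric.mem_ball.mpr hxz)
  rw [← dist_eq_norm x z] at hm
  have h3 := (le_abs_self _).trans hm
  have h4 : (‖fderiv ℝ w z‖ + δ) * dist x z ≤ (‖fderiv ℝ w z‖ + δ) * ε := by gcongr
  linarith

theorem volume_real_ball_plane {ε : ℝ} (hε : 0 ≤ ε) :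
    volume.real (Metric.ball (0 : Plane) ε) = ε ^ 2 * π := by
  rw [measureReal_def, EuclideanSpace.volume_ball_fin_two, ENNReal.toReal_mul, ENNReal.toReal_pow,
    ENNReal.toReal_ofReal hε, ENNReal.toReal_ofReal pi_pos.le]

/-- The isoperimetric content of the Brunn–Minkowski inequality: the linear term in `ε` of the
area of the `ε`-neighbourhood. -/
theorem volume_add_ofReal_le_volume_add_ball {S : Set Plane} (hS : IsOpen S)
    (hb : Bornology.IsBounded S) (hn : S.Nonempty) {ε : ℝ} (hε : 0 < ε) :
    volume S + ENNReal.ofReal (ε * (2 * √π * √(volume.real S))) ≤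
      volume (S + Metric.ball 0 ε) := by
  have h := volume_real_add_volume_real_add_le hS Metric.isOpen_ball hb Metric.isBounded_ball hn
    ⟨(0 : Plane), Metric.mem_ball_self hε⟩
  rw [volume_real_ball_plane hε.le, Real.sqrt_mul (by positivity), Real.sqrt_sq hε.le] at h
  rw [← ofReal_measureReal hb.measure_lt_top.ne,
    ← ofReal_measureReal (hb.add (Metric.isBounded_ball (x := 0) (r := ε))).measure_lt_top.ne,
    ← ENNReal.ofReal_add measureReal_nonneg (by positivity)]
  refine ENNReal.ofReal_le_ofReal ?_
  have : 0 ≤ ε ^ 2 * π := by positivity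
  linarith

theorem HasCompactSupport.isBounded_lt {w : Plane → ℝ} (hc : HasCompactSupport w) {τ : ℝ}
    (hτ : 0 ≤ τ) : Bornology.IsBounded {x | τ < w x} :=
  hc.isBounded.subset fun _ hx => subset_tsupport w
    (Function.mem_support.mpr (hτ.trans_lt hx).ne')

/-- Sharp Sobolev inequality of weak type in the plane: a `C¹` function of compact support that
is at least `c` on `E` has `L¹` gradient norm at least `c` times the perimeter of the disc of
area `|E|`. -/
theorem two_sqrt_pi_mul_le_integral_norm_fderiv {w : Plane → ℝ} (hw : ContDiff ℝ 1 w)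
    (hc : HasCompactSupport w) (h0 : ∀ x, 0 ≤ w x) {E : Set Plane} {c : ℝ} (hc0 : 0 ≤ c)
    (hE : ∀ x ∈ E, c ≤ w x) :
    c * (2 * √π * √(volume.real E)) ≤ ∫ x, ‖fderiv ℝ w x‖ := by
  rcases E.eq_empty_or_nonempty with rfl | hEn
  · simpa using integral_nonneg fun x => norm_nonneg (fderiv ℝ w x)
  set P := 2 * √π * √(volume.real E) with hP
  have hP0 : 0 ≤ P := by positivity
  set N : Set Plane := Metric.cthickening 1 (tsupport w) with hN
  have hNm : MeasurableSet N := Metric.isClosed_cthickening.measurableSet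
  have hNf : volume N < ⊤ := (Bornology.IsBounded.cthickening hc.isBounded).measure_lt_top
  have hwi : Integrable w := hw.continuous.integrable_of_hasCompactSupport hc
  have hdi : Integrable fun x => ‖fderiv ℝ w x‖ :=
    ((hw.continuous_fderiv one_ne_zero).integrable_of_hasCompactSupport (hc.fderiv ℝ)).norm
  have main : ∀ δ > 0, c * P ≤ (∫ x, ‖fderiv ℝ w x‖) + δ * volume.real N := by
    intro δ hδ
    obtain ⟨ε, hεle, hε0, hε1⟩ := ((eventually_le_add_mul_norm_fderiv hw hc hδ).and
      (Ioo_mem_nhdsGT (zero_lt_one' ℝ))).exists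
    -- `g` majorises `w` over `ε`-balls, so `{w > τ} + B_ε ⊆ {g > τ}`; the indicator keeps the
    -- error term `δ` integrable
    let g : Plane → ℝ := fun x => w x + ε * (‖fderiv ℝ w x‖ + N.indicator (fun _ => δ) x)
    have hind : ∀ x, 0 ≤ N.indicator (fun _ => δ) x := fun x => indicator_nonneg (fun _ _ => hδ.le) x
    have hwg : ∀ x, w x ≤ g x := fun x => by
      have := hind x
      simp only [g]
      have : 0 ≤ ε * (‖fderiv ℝ w x‖ + N.indicator (fun _ => δ) x) := by positivity
      linarith
    have hii : Integrable (N.indicator fun _ => δ) :=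
      (integrable_indicator_iff hNm).mpr (integrableOn_const hNf.ne)
    have hsi : Integrable fun x => ε * (‖fderiv ℝ w x‖ + N.indicator (fun _ => δ) x) :=
      (hdi.add hii).const_mul ε
    have hgi : Integrable g := hwi.add hsi
    have hgint : ∫ x, g x = (∫ x, w x) + ε * ((∫ x, ‖fderiv ℝ w x‖) + δ * volume.real N) := by
      simp only [g]
      rw [integral_add hwi hsi, integral_const_mul,
        integral_add hdi hii, integral_indicator hNm, setIntegral_const, smul_eq_mul, mul_comm δ]
    have hsub : ∀ τ, 0 ≤ τ → {x | τ < w x} + Metric.ball (0 : Plane) ε ⊆ {x | τ < g x} := by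
      rintro τ hτ _ ⟨x, hx, y, hy, rfl⟩
      have hx' : τ < w x := hx
      have hd : dist x (x + y) < ε := by
        rw [dist_eq_norm, sub_add_cancel_left, norm_neg]
        exact mem_ball_zero_iff.mp hy
      have h1 := hεle x (x + y) hd
      have hxs : x ∈ tsupport w := subset_tsupport w (Function.mem_support.mpr (by linarith))
      have h2 : x + y ∈ N := Metric.mem_cthickening_of_dist_le _ x _ _ hxs (by
        rw [dist_comm]
        linarith)
      change τ < g (x + y)
      simp only [g, indicator_of_mem h2]
      linarith
    have hlev : ∀ τ ∈ Ioi (0 : ℝ), volume {x | τ < w x} +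
        (Iio c).indicator (fun _ => ENNReal.ofReal (ε * P)) τ ≤ volume {x | τ < g x} := by
      intro τ hτ
      have hτ0 : 0 < τ := hτ
      by_cases hτc : τ < c
      · rw [indicator_of_mem (mem_Iio.mpr hτc)]
        have hEs : E ⊆ {x | τ < w x} := fun x hx => hτc.trans_le (hE x hx)
        have hbd := hc.isBounded_lt hτ0.le
        refine le_trans ?_ ((volume_add_ofReal_le_volume_add_ball
          (isOpen_lt continuous_const hw.continuous) hbd (hEn.mono hEs) hε0).trans
          (measure_mono (hsub τ hτ0.le)))
        have := measureReal_mono (μ := volume) hEs hbd.measure_lt_top.ne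
        rw [hP]
        gcongr
      · rw [indicator_of_notMem (show τ ∉ Iio c from hτc), add_zero]
        exact measure_mono fun x hx => lt_of_lt_of_le hx (hwg x)
    have hlay : (∫⁻ x, ENNReal.ofReal (w x)) + ENNReal.ofReal (ε * P) * ENNReal.ofReal c ≤
        ∫⁻ x, ENNReal.ofReal (g x) := by
      rw [lintegral_eq_lintegral_meas_lt _ (ae_of_all _ h0) hwi.aemeasurable,
        lintegral_eq_lintegral_meas_lt _ (ae_of_all _ fun x => (h0 x).trans (hwg x))
          hgi.aemeasurable]
      have hcst : ∫⁻ τ in Ioi 0, (Iio c).indicator (fun _ => ENNReal.ofReal (ε * P)) τ =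
          ENNReal.ofReal (ε * P) * ENNReal.ofReal c := by
        rw [lintegral_indicator_const measurableSet_Iio, Measure.restrict_apply measurableSet_Iio,
          inter_comm, Ioi_inter_Iio, Real.volume_Ioo, sub_zero]
      rw [← hcst, ← lintegral_add_right _ (measurable_const.indicator measurableSet_Iio)]
      exact setLIntegral_mono' measurableSet_Ioi hlev
    rw [← ofReal_integral_eq_lintegral_ofReal hwi (ae_of_all _ h0),
      ← ofReal_integral_eq_lintegral_ofReal hgi (ae_of_all _ fun x => (h0 x).trans (hwg x)),
      ← ENNReal.ofReal_mul (by positivity), ← ENNReal.ofReal_add (integral_nonneg h0)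
        (by positivity), ENNReal.ofReal_le_ofReal_iff
        (integral_nonneg fun x => (h0 x).trans (hwg x)), hgint] at hlay
    have : ε * (c * P) ≤ ε * ((∫ x, ‖fderiv ℝ w x‖) + δ * volume.real N) := by linarith
    exact le_of_mul_le_mul_left this hε0
  have hlim : Tendsto (fun δ => (∫ x, ‖fderiv ℝ w x‖) + δ * volume.real N) (𝓝[>] 0)
      (𝓝 ((∫ x, ‖fderiv ℝ w x‖) + 0 * volume.real N)) :=
    (Continuous.tendsto (by fun_prop) 0).mono_left nhdsWithin_le_nhds
  rw [zero_mul, add_zero] at hlim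
  exact ge_of_tendsto hlim (eventually_mem_nhdsWithin.mono main)

/-! ### The level-set inequality -/

/-- The flat Laplacian. -/
noncomputable def flatLaplacian (f : Plane → ℝ) (x : Plane) : ℝ :=
  ∑ i, partialDeriv i (partialDeriv i f) x

/-- The primitive of `χ` vanishing at `-∞`. -/
noncomputable def primitive (χ : ℝ → ℝ) (y : ℝ) : ℝ := ∫ τ in Iio y, χ τ

theorem hasDerivAt_primitive {χ : ℝ → ℝ} (hχ : Continuous χ) (hi : Integrable χ) (y : ℝ) :
    HasDerivAt (primitive χ) (χ y) y := by
  have h : primitive χ = fun y => (∫ τ in (0 : ℝ)..y, χ τ) + ∫ τ in Iic 0, χ τ := by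
    ext y
    rw [primitive, ← integral_Iic_eq_integral_Iio,
      ← intervalIntegral.integral_Iic_sub_Iic hi.integrableOn hi.integrableOn, sub_add_cancel]
  rw [h]
  exact (intervalIntegral.integral_hasDerivAt_right (hχ.intervalIntegrable _ _)
    hχ.aestronglyMeasurable.stronglyMeasurableAtFilter hχ.continuousAt).add_const _

theorem contDiff_primitive {χ : ℝ → ℝ} (hχ : Continuous χ) (hi : Integrable χ) :
    ContDiff ℝ 1 (primitive χ) := by
  have h := hasDerivAt_primitive hχ hi
  rw [contDiff_one_iff_deriv]
  refine ⟨fun y => (h y).differentiableAt, ?_⟩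
  rwa [show deriv (primitive χ) = χ from funext fun y => (h y).deriv]

theorem contDiff_partialDeriv {f : Plane → ℝ} (hf : ContDiff ℝ ∞ f) (i : Fin 2) :
    ContDiff ℝ ∞ (partialDeriv i f) :=
  (hf.fderiv_right (m := ∞) (by simp)).clm_apply contDiff_const

theorem hasCompactSupport_partialDeriv {f : Plane → ℝ} (hf : HasCompactSupport f) (i : Fin 2) :
    HasCompactSupport (partialDeriv i f) :=
  hf.fderiv_apply (𝕜 := ℝ) _

theorem continuous_flatLaplacian {f : Plane → ℝ} (hf : ContDiff ℝ ∞ f) :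
    Continuous (flatLaplacian f) :=
  continuous_finsetSum _ fun i _ =>
    (contDiff_partialDeriv (contDiff_partialDeriv hf i) i).continuous

theorem hasCompactSupport_flatLaplacian {f : Plane → ℝ} (hf : HasCompactSupport f) :
    HasCompactSupport (flatLaplacian f) := by
  have h : flatLaplacian f = ∑ i, partialDeriv i (partialDeriv i f) := by
    ext x
    simp [flatLaplacian]
  rw [h, Fin.sum_univ_two]
  exact (hasCompactSupport_partialDeriv (hasCompactSupport_partialDeriv hf 0) 0).add
    (hasCompactSupport_partialDeriv (hasCompactSupport_partialDeriv hf 1) 1)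

theorem norm_fderiv_sq (f : Plane → ℝ) (x : Plane) :
    ‖fderiv ℝ f x‖ ^ 2 = ∑ i, partialDeriv i f x ^ 2 := by
  rw [(EuclideanSpace.basisFun (Fin 2) ℝ).norm_dual]
  simp [partialDeriv]

theorem primitive_of_nonpos {χ : ℝ → ℝ} (hχ0 : ∀ y ≤ 0, χ y = 0) {y : ℝ} (hy : y ≤ 0) :
    primitive χ y = 0 :=
  setIntegral_eq_zero_of_forall_eq_zero fun τ hτ => hχ0 τ ((mem_Iio.mp hτ).le.trans hy)

theorem hasCompactSupport_primitive_comp {U : Plane → ℝ} (hUc : HasCompactSupport U) {χ : ℝ → ℝ}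
    (hχ0 : ∀ y ≤ 0, χ y = 0) : HasCompactSupport fun x => primitive χ (U x) :=
  hUc.comp_left (primitive_of_nonpos hχ0 le_rfl)

theorem fderiv_primitive_comp {U : Plane → ℝ} (hU : ContDiff ℝ ∞ U) {χ : ℝ → ℝ}
    (hχ : Continuous χ) (hχi : Integrable χ) (x : Plane) :
    fderiv ℝ (fun x => primitive χ (U x)) x = χ (U x) • fderiv ℝ U x :=
  ((hasDerivAt_primitive hχ hχi (U x)).comp_hasFDerivAt x
    ((hU.differentiable (by simp)) x).hasFDerivAt).fderiv

/-- Energy identity: testing `-ΔU` against a function of `U`. -/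
theorem integral_comp_mul_norm_fderiv_sq {U : Plane → ℝ} (hU : ContDiff ℝ ∞ U)
    (hUc : HasCompactSupport U) {χ : ℝ → ℝ} (hχ : Continuous χ) (hχi : Integrable χ)
    (hχ0 : ∀ y ≤ 0, χ y = 0) :
    ∫ x, χ (U x) * ‖fderiv ℝ U x‖ ^ 2 = ∫ x, -flatLaplacian U x * primitive χ (U x) := by
  have hφ : ContDiff ℝ 1 fun x => primitive χ (U x) :=
    (contDiff_primitive hχ hχi).comp (hU.of_le (by simp))
  have hφc := hasCompactSupport_primitive_comp hUc hχ0
  have hχU : Continuous fun x => χ (U x) := hχ.comp hU.continuous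
  have hi1 : ∀ i, Integrable fun x => primitive χ (U x) * partialDeriv i (partialDeriv i U) x :=
    fun i => (hφ.continuous.mul
      (contDiff_partialDeriv (contDiff_partialDeriv hU i) i).continuous)
        |>.integrable_of_hasCompactSupport hφc.mul_right
  have hi2 : ∀ i, Integrable fun x => χ (U x) * partialDeriv i U x ^ 2 := fun i =>
    (hχU.mul ((contDiff_partialDeriv hU i).continuous.pow 2)).integrable_of_hasCompactSupport
      ((hUc.comp_left (hχ0 0 le_rfl)).mul_right)
  have hibp : ∀ i, ∫ x, primitive χ (U x) * partialDeriv i (partialDeriv i U) x =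
      -∫ x, χ (U x) * partialDeriv i U x ^ 2 := by
    intro i
    have e : ∀ x, fderiv ℝ (fun x => primitive χ (U x)) x (EuclideanSpace.single i 1) *
        partialDeriv i U x = χ (U x) * partialDeriv i U x ^ 2 := fun x => by
      rw [fderiv_primitive_comp hU hχ hχi]
      simp only [smul_apply, smul_eq_mul, partialDeriv]
      ring
    have := integral_mul_fderiv_eq_neg_fderiv_mul_of_integrable (μ := volume)
      (f := fun x => primitive χ (U x)) (g := partialDeriv i U)
      (v := EuclideanSpace.single i (1 : ℝ)) (by simpa only [e] using hi2 i) (hi1 i)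
      ((hφ.continuous.mul (contDiff_partialDeriv hU i).continuous)
        |>.integrable_of_hasCompactSupport hφc.mul_right)
      (fun x _ => hφ.differentiable one_ne_zero x)
      (fun x _ => (contDiff_partialDeriv hU i).differentiable (by simp) x)
    simp only [e] at this
    exact this
  have e1 : ∀ x, χ (U x) * ‖fderiv ℝ U x‖ ^ 2 = ∑ i, χ (U x) * partialDeriv i U x ^ 2 :=
    fun x => by rw [norm_fderiv_sq, Finset.mul_sum]
  have e2 : ∀ x, -flatLaplacian U x * primitive χ (U x) =
      -∑ i, primitive χ (U x) * partialDeriv i (partialDeriv i U) x := fun x => by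
    rw [flatLaplacian, ← Finset.mul_sum]
    ring
  simp_rw [e1, e2]
  rw [integral_neg, integral_finsetSum _ fun i _ => hi2 i, integral_finsetSum _ fun i _ => hi1 i]
  simp [hibp]

/-- Layer-cake (Fubini) formula for an integral against a function of `U`. -/
theorem integral_mul_primitive_comp {U f : Plane → ℝ} (hU : Continuous U) (hf : Integrable f)
    {χ : ℝ → ℝ} (hχi : Integrable χ) :
    (Integrable fun τ => χ τ * ∫ x in {x | τ < U x}, f x) ∧
      ∫ x, f x * primitive χ (U x) = ∫ τ, χ τ * ∫ x in {x | τ < U x}, f x := by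
  have hm : MeasurableSet {p : Plane × ℝ | p.2 < U p.1} :=
    (isOpen_lt continuous_snd (hU.comp continuous_fst)).measurableSet
  have hint : Integrable (Function.uncurry fun (x : Plane) (τ : ℝ) =>
      {p : Plane × ℝ | p.2 < U p.1}.indicator (fun p => f p.1 * χ p.2) (x, τ))
      (volume.prod volume) := (hf.mul_prod hχi).indicator hm
  have h := integral_integral_swap hint
  have h1 : ∀ x, ∫ τ, {p : Plane × ℝ | p.2 < U p.1}.indicator (fun p => f p.1 * χ p.2) (x, τ) =
      f x * primitive χ (U x) := by
    intro x
    rw [primitive, ← integral_const_mul, ← integral_indicator measurableSet_Iio]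
    rfl
  have h2 : ∀ τ, ∫ x, {p : Plane × ℝ | p.2 < U p.1}.indicator (fun p => f p.1 * χ p.2) (x, τ) =
      χ τ * ∫ x in {x | τ < U x}, f x := by
    intro τ
    rw [← integral_const_mul, ← integral_indicator (isOpen_lt continuous_const hU).measurableSet]
    refine integral_congr_ae (ae_of_all _ fun x => ?_)
    simp only [indicator, mem_ofPred_eq, mul_comm]
  simp_rw [h1, h2] at h
  refine ⟨?_, h⟩
  simpa only [Function.uncurry_apply_pair, h2] using hint.integral_prod_right

/-- Cauchy–Schwarz with weight `a`. -/
theorem integral_mul_sq_le {a b : Plane → ℝ} (ha : ∀ x, 0 ≤ a x) (hai : Integrable a)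
    (hab : Integrable fun x => a x * b x) (hab2 : Integrable fun x => a x * b x ^ 2) :
    (∫ x, a x * b x) ^ 2 ≤ (∫ x, a x * b x ^ 2) * ∫ x, a x := by
  -- the quadratic `l ↦ ∫ a (l b - 1) ^ 2` is nonnegative
  have h : ∀ l : ℝ, 0 ≤ (∫ x, a x * b x ^ 2) * (l * l) + (-2 * ∫ x, a x * b x) * l +
      ∫ x, a x := by
    intro l
    have h0 : 0 ≤ ∫ x, a x * (b x * l - 1) ^ 2 :=
      integral_nonneg fun x => mul_nonneg (ha x) (sq_nonneg _)
    have e : ∀ x, a x * (b x * l - 1) ^ 2 =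
        (l * l) * (a x * b x ^ 2) + (-2 * l) * (a x * b x) + a x := fun x => by ring
    simp_rw [e] at h0
    have hi1 : Integrable fun x => (l * l) * (a x * b x ^ 2) := hab2.const_mul _
    have hi2 : Integrable fun x => (-2 * l) * (a x * b x) := hab.const_mul _
    have hi3 : Integrable fun x => (l * l) * (a x * b x ^ 2) + (-2 * l) * (a x * b x) :=
      hi1.add hi2
    rw [integral_add hi3 hai, integral_add hi1 hi2, integral_const_mul, integral_const_mul] at h0
    linarith
  have := discrim_le_zero h
  rw [discrim] at this
  linarith

/-- The level-set inequality before passing to a sharp cut-off: Sobolev, Cauchy–Schwarz and the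
energy identity for a cut-off `χ ≤ 1` supported in `[s, t]`. -/
theorem four_pi_mul_integral_mul_le {U : Plane → ℝ} (hU : ContDiff ℝ ∞ U)
    (hUc : HasCompactSupport U) {s t k : ℝ} (hs : 0 < s) {χ : ℝ → ℝ} (hχ : Continuous χ)
    (hχ0 : ∀ y, 0 ≤ χ y) (hχ1 : ∀ y, χ y ≤ 1) (hχs : ∀ y, y ∉ Ioo s t → χ y = 0)
    (hk : ∀ τ ∈ Ioo s t, ∫ x in {x | τ < U x}, -flatLaplacian U x ≤ k) (hI : 0 < ∫ y, χ y) :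
    4 * π * (∫ y, χ y) * volume.real {x | t < U x} ≤
      (volume.real {x | s < U x} - volume.real {x | t < U x}) * k := by
  have hχc : HasCompactSupport χ :=
    HasCompactSupport.intro (isCompact_Icc (a := s) (b := t)) fun y hy =>
      hχs y fun h => hy (Ioo_subset_Icc_self h)
  have hχi : Integrable χ := hχ.integrable_of_hasCompactSupport hχc
  have hχn : ∀ y ≤ 0, χ y = 0 := fun y hy => hχs y fun h => by linarith [h.1]
  have hχU : Continuous fun x => χ (U x) := hχ.comp hU.continuous
  have hχUc : HasCompactSupport fun x => χ (U x) := hUc.comp_left (hχn 0 le_rfl)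
  have hdU : Continuous fun x => ‖fderiv ℝ U x‖ := (hU.continuous_fderiv (by simp)).norm
  set c := ∫ y, χ y with hc
  set V := volume.real {x | t < U x} with hV
  -- Sobolev inequality for the primitive of `χ` along `U`
  have sob : c * (2 * √π * √V) ≤ ∫ x, χ (U x) * ‖fderiv ℝ U x‖ := by
    have h := two_sqrt_pi_mul_le_integral_norm_fderiv
      ((contDiff_primitive hχ hχi).comp (hU.of_le (by simp)))
      (hasCompactSupport_primitive_comp hUc hχn)
      (fun x => setIntegral_nonneg measurableSet_Iio fun y _ => hχ0 y)
      (E := {x | t < U x}) hI.le (fun x hx => by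
        have hx' : t < U x := hx
        rw [hc, Function.comp_apply, primitive, setIntegral_eq_integral_of_forall_compl_eq_zero]
        intro y hy
        exact hχs y fun h => hy (h.2.trans hx'))
    refine h.trans_eq (integral_congr_ae (ae_of_all _ fun x => ?_))
    have := fderiv_primitive_comp hU hχ hχi x
    simp only [Function.comp_def, this, norm_smul, Real.norm_of_nonneg (hχ0 _)]
  have energy : ∫ x, χ (U x) * ‖fderiv ℝ U x‖ ^ 2 ≤ c * k := by
    rw [integral_comp_mul_norm_fderiv_sq hU hUc hχ hχi hχn]
    have hLi : Integrable fun x => -flatLaplacian U x :=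
      ((continuous_flatLaplacian hU).integrable_of_hasCompactSupport
        (hasCompactSupport_flatLaplacian hUc)).neg
    obtain ⟨hi, heq⟩ := integral_mul_primitive_comp hU.continuous hLi hχi
    rw [heq, hc, ← integral_mul_const]
    refine integral_mono hi (hχi.mul_const k) fun τ => ?_
    by_cases hτ : τ ∈ Ioo s t
    · exact mul_le_mul_of_nonneg_left (hk τ hτ) (hχ0 τ)
    · simp [hχs τ hτ]
  -- `χ ∘ U` is at most `1` and vanishes outside `{s < U < t}`
  have mass : ∫ x, χ (U x) ≤ volume.real {x | s < U x} - V := by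
    have hs' := hUc.isBounded_lt hs.le
    by_cases hst : s ≤ t
    · have hsub : {x | t < U x} ⊆ {x | s < U x} := fun x hx => lt_of_le_of_lt hst hx
      have hm := (isOpen_lt continuous_const hU.continuous : IsOpen {x | t < U x}).measurableSet
      have hm' := (isOpen_lt continuous_const hU.continuous : IsOpen {x | s < U x}).measurableSet
      rw [hV, ← measureReal_sdiff hsub hm hs'.measure_lt_top.ne, ← integral_indicator_one (hm'.diff hm)]
      refine integral_mono (hχU.integrable_of_hasCompactSupport hχUc) ?_ fun x => ?_
      · refine (integrable_indicator_iff (hm'.diff hm)).mpr (integrableOn_const ?_)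
        exact (lt_of_le_of_lt (measure_mono sdiff_subset) hs'.measure_lt_top).ne
      · by_cases hx : U x ∈ Ioo s t
        · have hx' : x ∈ {x | s < U x} \ {x | t < U x} := ⟨hx.1, fun h => lt_asymm hx.2 h⟩
          rw [indicator_of_mem hx']
          exact hχ1 _
        · simp only [hχs _ hx]
          exact indicator_nonneg (fun _ _ => zero_le_one) _
    · have : c = 0 := by
        rw [hc, show χ = 0 from funext fun y => hχs y fun h => hst (h.1.trans h.2).le]
        simp
      exact absurd this hI.ne'
  have cs := integral_mul_sq_le (fun x => hχ0 (U x))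
    (hχU.integrable_of_hasCompactSupport hχUc)
    ((hχU.mul hdU).integrable_of_hasCompactSupport hχUc.mul_right)
    ((hχU.mul (hdU.pow 2)).integrable_of_hasCompactSupport hχUc.mul_right)
  have h1 : (c * (2 * √π * √V)) ^ 2 ≤ (∫ x, χ (U x) * ‖fderiv ℝ U x‖) ^ 2 := by gcongr
  have h2 : (c * (2 * √π * √V)) ^ 2 = c * (4 * π * c * V) := by
    have hp : √π ^ 2 = π := Real.sq_sqrt pi_pos.le
    have hv : √V ^ 2 = V := Real.sq_sqrt measureReal_nonneg
    linear_combination (4 * c ^ 2 * √V ^ 2) * hp + (4 * c ^ 2 * π) * hv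
  have hm0 : 0 ≤ ∫ x, χ (U x) := integral_nonneg fun x => hχ0 _
  have he0 : 0 ≤ ∫ x, χ (U x) * ‖fderiv ℝ U x‖ ^ 2 :=
    integral_nonneg fun x => mul_nonneg (hχ0 _) (sq_nonneg _)
  have h3 : (∫ x, χ (U x) * ‖fderiv ℝ U x‖ ^ 2) * ∫ x, χ (U x) ≤
      c * k * (volume.real {x | s < U x} - V) :=
    mul_le_mul energy mass hm0 (he0.trans energy)
  have h4 : c * (4 * π * c * V) ≤ c * ((volume.real {x | s < U x} - V) * k) := by
    linarith
  exact le_of_mul_le_mul_left h4 hI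

/-- The differential inequality for the distribution function `V` of `U`, in integrated form:
`4π V ≤ -V' · ∫_{U > τ} (-ΔU)`. -/
theorem four_pi_mul_sub_mul_le {U : Plane → ℝ} (hU : ContDiff ℝ ∞ U)
    (hUc : HasCompactSupport U) {s t k : ℝ} (hs : 0 < s) (hst : s < t)
    (hk : ∀ τ ∈ Ioo s t, ∫ x in {x | τ < U x}, -flatLaplacian U x ≤ k) :
    4 * π * (t - s) * volume.real {x | t < U x} ≤
      (volume.real {x | s < U x} - volume.real {x | t < U x}) * k := by
  have key : ∀ d ∈ Ioo 0 (t - s), 4 * π * d * volume.real {x | t < U x} ≤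
      (volume.real {x | s < U x} - volume.real {x | t < U x}) * k := by
    intro d hd
    -- a bump function equal to `1` on an interval of length `d` inside `(s, t)`
    let χ : ContDiffBump ((s + t) / 2) :=
      ⟨d / 2, (t - s) / 2, by linarith [hd.1], by linarith [hd.2]⟩
    have hI : d ≤ ∫ y, χ y := by
      have := χ.measure_closedBall_le_integral (μ := volume)
      rw [measureReal_def, Real.volume_closedBall, ENNReal.toReal_ofReal
        (by linarith [χ.rIn_pos])] at this
      exact (by simp only [χ]; linarith : d ≤ 2 * χ.rIn).trans this
    refine le_trans ?_ (four_pi_mul_integral_mul_le hU hUc hs χ.continuous (fun _ => χ.nonneg)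
      (fun _ => χ.le_one) (fun y hy => χ.zero_of_le_dist ?_) hk (hd.1.trans_le hI))
    · gcongr
    · by_contra h
      refine hy ?_
      rw [not_le, Real.dist_eq, abs_lt] at h
      simp only [χ] at h
      exact ⟨by linarith [h.1], by linarith [h.2]⟩
  have hlim : Tendsto (fun d => 4 * π * d * volume.real {x | t < U x}) (𝓝[<] (t - s))
      (𝓝 (4 * π * (t - s) * volume.real {x | t < U x})) :=
    (Continuous.tendsto (by fun_prop) _).mono_left nhdsWithin_le_nhds
  exact le_of_tendsto hlim
    (Filter.mem_of_superset (Ioo_mem_nhdsLT (by linarith)) key)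

/-! ### Comparison for the area functions -/

/-- A comparison principle for functions that may jump: to the right the increments of `f` are
negligible against those of a monotone `g`, and `f` never jumps upwards from the left. -/
theorem le_of_eventually_le_add_mul {f g : ℝ → ℝ} {a b : ℝ} (hab : a ≤ b)
    (hg : MonotoneOn g (Icc a b))
    (hr : ∀ s ∈ Ico a b, ∀ ε > 0, ∀ᶠ t in 𝓝[>] s, f t ≤ f s + ε * (g t - g s))
    (hl : ∀ t ∈ Ioc a b, ∀ ε > 0, ∀ᶠ s in 𝓝[<] t, f t ≤ f s + ε) : f b ≤ f a := by
  have key : ∀ ε > 0, f b ≤ f a + ε * (g b - g a) := by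
    intro ε hε
    let S : Set ℝ := {t ∈ Icc a b | f t ≤ f a + ε * (g t - g a)}
    have haS : a ∈ S := ⟨left_mem_Icc.mpr hab, by simp⟩
    have hbdd : BddAbove S := ⟨b, fun t ht => ht.1.2⟩
    have hle : a ≤ sSup S := le_csSup hbdd haS
    have hleb : sSup S ≤ b := csSup_le ⟨a, haS⟩ fun t ht => ht.1.2
    have hmem : sSup S ∈ S := by
      by_contra hnot
      have hlt : a < sSup S := lt_of_le_of_ne hle fun h => hnot (h ▸ haS)
      refine hnot ⟨⟨hle, hleb⟩, le_of_forall_pos_le_add fun η hη => ?_⟩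
      obtain ⟨l, hl1, hl2⟩ := (mem_nhdsLT_iff_exists_Ioo_subset).mp (hl _ ⟨hlt, hleb⟩ η hη)
      obtain ⟨s, hsS, hls⟩ := exists_lt_of_lt_csSup ⟨a, haS⟩ hl1
      have hss : s < sSup S := lt_of_le_of_ne (le_csSup hbdd hsS) fun h => hnot (h ▸ hsS)
      have h1 : f (sSup S) ≤ f s + η := hl2 ⟨hls, hss⟩
      have h2 := hsS.2
      have h3 : g s ≤ g (sSup S) := hg hsS.1 ⟨hle, hleb⟩ hss.le
      have h4 : ε * (g s - g a) ≤ ε * (g (sSup S) - g a) := by gcongr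
      linarith
    rcases hleb.eq_or_lt with h | h
    · exact h ▸ hmem.2
    · obtain ⟨t, ht, hst⟩ := ((hr _ ⟨hle, h⟩ ε hε).and (Ioc_mem_nhdsGT h)).exists
      have : t ∈ S := ⟨⟨hle.trans hst.1.le, hst.2⟩, by linarith [hmem.2]⟩
      exact absurd (le_csSup hbdd this) (not_le.mpr hst.1)
  have hlim : Tendsto (fun ε => f a + ε * (g b - g a)) (𝓝[>] 0) (𝓝 (f a + 0 * (g b - g a))) :=
    (Continuous.tendsto (by fun_prop) 0).mono_left nhdsWithin_le_nhds
  rw [zero_mul, add_zero] at hlim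
  exact ge_of_tendsto hlim (eventually_mem_nhdsWithin.mono key)

/-- The properties shared by the Euclidean area `V t` and the area `A t` with respect to
`e^{2u} g₀` of the superlevel sets `{u > t}` of a function with maximum `M`. -/
structure IsLevelAreaPair (V A : ℝ → ℝ) (M : ℝ) : Prop where
  antitone : Antitone V
  nonneg : ∀ t, 0 ≤ V t
  nonneg' : ∀ t, 0 ≤ A t
  lower : ∀ ⦃s t⦄, s ≤ t → exp (2 * s) * (V s - V t) ≤ A s - A t
  upper : ∀ ⦃s t⦄, s ≤ t → A s - A t ≤ exp (2 * t) * (V s - V t)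
  tendsto_right : ∀ s, Tendsto V (𝓝[>] s) (𝓝 (V s))
  eq_zero : V M = 0
  eq_zero' : A M = 0
  pos : ∀ s < M, 0 < A s

namespace IsLevelAreaPair

variable {V A : ℝ → ℝ} {M : ℝ}

theorem antitone_right (h : IsLevelAreaPair V A M) : Antitone A := fun s t hst => by
  have h1 := h.lower hst
  have h2 := mul_nonneg (exp_pos (2 * s)).le (sub_nonneg.mpr (h.antitone hst))
  linarith

theorem tendsto_nhdsLE (h : IsLevelAreaPair V A M) (s : ℝ) :
    Tendsto A (𝓝[>] s) (𝓝[≤] (A s)) := by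
  refine tendsto_nhdsWithin_iff.mpr ⟨?_, eventually_mem_nhdsWithin.mono fun t ht =>
    h.antitone_right (le_of_lt ht)⟩
  have hexp : Tendsto (fun t => exp (2 * t)) (𝓝[>] s) (𝓝 (exp (2 * s))) :=
    (Continuous.tendsto (by fun_prop) s).mono_left nhdsWithin_le_nhds
  have h1 : Tendsto (fun t => A s - exp (2 * t) * (V s - V t)) (𝓝[>] s) (𝓝 (A s)) := by
    simpa using (tendsto_const_nhds (x := A s)).sub
      (hexp.mul ((tendsto_const_nhds (x := V s)).sub (h.tendsto_right s)))
  refine tendsto_of_tendsto_of_tendsto_of_le_of_le' h1 tendsto_const_nhds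
    (eventually_mem_nhdsWithin.mono fun t ht => ?_)
    (eventually_mem_nhdsWithin.mono fun t ht => h.antitone_right (le_of_lt ht))
  have := h.upper (le_of_lt ht)
  linarith

theorem eventually_abs_sub_le (h : IsLevelAreaPair V A M) {Ψ : ℝ → ℝ} {d s : ℝ}
    (hΨ : HasDerivWithinAt Ψ d (Iic (A s)) (A s)) {ε : ℝ} (hε : 0 < ε) :
    ∀ᶠ t in 𝓝[>] s, |Ψ (A s) - Ψ (A t) - (A s - A t) * d| ≤ ε * (A s - A t) := by
  have h1 := (hasDerivWithinAt_iff_isLittleO.mp hΨ).def hε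
  filter_upwards [(h.tendsto_nhdsLE s).eventually h1, self_mem_nhdsWithin] with t ht hst
  have h0 := h.antitone_right (le_of_lt hst)
  rw [smul_eq_mul, Real.norm_eq_abs, Real.norm_eq_abs, abs_sub_comm (A t) (A s),
    abs_of_nonneg (sub_nonneg.mpr h0)] at ht
  rwa [← abs_neg, show -(Ψ (A s) - Ψ (A t) - (A s - A t) * d) =
    Ψ (A t) - Ψ (A s) - (A t - A s) * d by ring]

/-- `Φ` is the solution of `Φ' = 1 - K / 2π`, `Φ(0) = 0`, a lower bound for `e^{2t} V` in terms
of `A`. At a jump of `A` the quantity `e^{2t} V` jumps by the same amount, while `Φ` jumps by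
no more. -/
theorem le_exp_mul (h : IsLevelAreaPair V A M) {K Φ : ℝ → ℝ}
    (hmain : ∀ s t, 0 < s → s < t → 4 * π * (t - s) * V t ≤ (V s - V t) * K (A s))
    (hK : ∀ a, 0 < a → 0 ≤ K a) (hΦ0 : Φ 0 = 0)
    (hΦl : ∀ a' a, 0 ≤ a' → a' ≤ a → Φ a - Φ a' ≤ a - a')
    (hΦd : ∀ a, 0 < a → HasDerivWithinAt Φ (1 - K a / (2 * π)) (Iic a) a) {s₀ : ℝ}
    (hs₀ : 0 < s₀) (hs₀M : s₀ ≤ M) : Φ (A s₀) ≤ exp (2 * s₀) * V s₀ := by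
  have key := le_of_eventually_le_add_mul (f := fun t => exp (2 * t) * V t - Φ (A t))
    (g := fun t => -A t) hs₀M (fun s _ t _ hst => neg_le_neg (h.antitone_right hst)) ?_ ?_
  · simp only [h.eq_zero, h.eq_zero', hΦ0, mul_zero, sub_zero] at key
    linarith
  · intro s hs ε hε
    have hAs := h.pos s hs.2
    set k := K (A s) with hk
    have hk0 : 0 ≤ k := hK _ hAs
    have hlim : Tendsto (fun t => (exp (2 * (t - s)) - 1) * k / (2 * π) +
        (1 - (exp (2 * (t - s)))⁻¹)) (𝓝[>] s) (𝓝 ((exp (2 * (s - s)) - 1) * k / (2 * π) +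
        (1 - (exp (2 * (s - s)))⁻¹))) :=
      (Continuous.tendsto (by fun_prop (disch := exact fun _ => (exp_pos _).ne')) s).mono_left
        nhdsWithin_le_nhds
    have hz : (exp (2 * (s - s)) - 1) * k / (2 * π) + (1 - (exp (2 * (s - s)))⁻¹) = 0 := by simp
    rw [hz] at hlim
    filter_upwards [h.eventually_abs_sub_le (hΦd _ hAs) (half_pos hε),
      hlim.eventually_lt_const (half_pos hε), self_mem_nhdsWithin] with t ht1 ht2 hst
    have hst' : s < t := hst
    have hW := h.upper hst'.le
    have hW' := h.lower hst'.le
    have hmn := hmain s t (hs₀.trans_le hs.1) hst'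
    rw [← hk] at hmn
    have het : exp (2 * t) = exp (2 * s) * exp (2 * (t - s)) := by
      rw [← exp_add]
      ring_nf
    have hD0 := sub_nonneg.mpr (h.antitone_right hst'.le)
    have hV0 := h.nonneg t
    set D := A s - A t with hD
    set W := V s - V t with hWd
    set E := exp (2 * (t - s)) with hE
    have hE0 : 0 < E := exp_pos _
    have hes : 0 < exp (2 * s) := exp_pos _
    have hEinv : 1 - 2 * (t - s) ≤ E⁻¹ := by
      rw [hE, ← exp_neg]
      have := add_one_le_exp (-(2 * (t - s)))
      linarith
    -- `E - 1 ≤ 2 (t - s) E`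
    have hE1 : E - 1 ≤ 2 * (t - s) * E := by
      have := mul_le_mul_of_nonneg_right hEinv hE0.le
      rw [inv_mul_cancel₀ hE0.ne'] at this
      linarith
    have b1 : exp (2 * s) * (4 * π * (t - s) * V t) ≤ D * k :=
      (mul_le_mul_of_nonneg_left hmn hes.le).trans (by
        rw [← mul_assoc]
        exact mul_le_mul_of_nonneg_right hW' hk0)
    have b2 : exp (2 * s) * (E - 1) * V t ≤ E * (D * k / (2 * π)) := by
      have e1 : exp (2 * s) * (E - 1) * V t ≤ exp (2 * s) * (2 * (t - s) * E) * V t := by gcongr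
      refine e1.trans ?_
      rw [show exp (2 * s) * (2 * (t - s) * E) * V t =
        E * ((exp (2 * s) * (4 * π * (t - s) * V t)) / (2 * π)) by field_simp; ring]
      gcongr
    have b3 : E⁻¹ * D ≤ exp (2 * s) * W := by
      rw [het] at hW
      rw [inv_mul_le_iff₀ hE0]
      linarith
    have b4 := (abs_le.mp ht1).2
    have b5 := mul_le_mul_of_nonneg_left ht2.le hD0
    have e2 : exp (2 * t) * V t - exp (2 * s) * V s = exp (2 * s) * (E - 1) * V t -
        exp (2 * s) * W := by
      rw [het, hWd]
      ring
    have e3 : -A t - -A s = D := by rw [hD]; ring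
    simp only [e3]
    have e4 : D * ((E - 1) * k / (2 * π) + (1 - E⁻¹)) =
        E * (D * k / (2 * π)) - E⁻¹ * D + D * (1 - k / (2 * π)) := by ring
    rw [← hk] at b4
    linarith
  · intro t ht ε hε
    have hlim : Tendsto (fun s => (exp (2 * t) - exp (2 * s)) * V s₀) (𝓝[<] t)
        (𝓝 ((exp (2 * t) - exp (2 * t)) * V s₀)) :=
      (Continuous.tendsto (by fun_prop) t).mono_left nhdsWithin_le_nhds
    rw [sub_self, zero_mul] at hlim
    filter_upwards [hlim.eventually_lt_const hε, Ioo_mem_nhdsLT ht.1] with s h1 hs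
    have hst : s ≤ t := hs.2.le
    have hu := h.upper hst
    have hp := hΦl (A t) (A s) (h.nonneg' t) (h.antitone_right hst)
    have hm : (exp (2 * t) - exp (2 * s)) * V s ≤ (exp (2 * t) - exp (2 * s)) * V s₀ := by
      have := h.antitone hs.1.le
      have : exp (2 * s) ≤ exp (2 * t) := exp_le_exp.mpr (by linarith)
      gcongr
    linarith

/-- The time `M - s` needed for `A` to decrease to `0`, estimated by the solution `H` of
`H' = K / (4π Φ)`. -/
theorem sub_le_of_hasDerivWithinAt (h : IsLevelAreaPair V A M) {K Φ H : ℝ → ℝ}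
    (hmain : ∀ s t, 0 < s → s < t → 4 * π * (t - s) * V t ≤ (V s - V t) * K (A s))
    (hK : ∀ a, 0 < a → 0 ≤ K a) (hΦ0 : Φ 0 = 0) (hΦpos : ∀ a, 0 < a → 0 < Φ a)
    (hΦl : ∀ a' a, 0 ≤ a' → a' ≤ a → Φ a - Φ a' ≤ a - a')
    (hΦd : ∀ a, 0 < a → HasDerivWithinAt Φ (1 - K a / (2 * π)) (Iic a) a)
    (hH : ∀ a' a, 0 ≤ a' → a' ≤ a → H a' ≤ H a)
    (hHd : ∀ a, 0 < a → HasDerivWithinAt H (K a / (4 * π * Φ a)) (Iic a) a) {s₀ : ℝ}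
    (hs₀ : 0 < s₀) (hs₀M : s₀ ≤ M) : M - s₀ ≤ H (A s₀) - H 0 := by
  have key := le_of_eventually_le_add_mul (f := fun t => t + H (A t))
    (g := fun t => -A t) hs₀M (fun s _ t _ hst => neg_le_neg (h.antitone_right hst)) ?_ ?_
  · simp only [h.eq_zero'] at key
    linarith
  · intro s hs ε hε
    have hAs := h.pos s hs.2
    have hΦs := hΦpos _ hAs
    have hΦt : Tendsto (fun t => Φ (A t)) (𝓝[>] s) (𝓝 (Φ (A s))) :=
      (hΦd _ hAs).continuousWithinAt.tendsto.comp (h.tendsto_nhdsLE s)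
    have hEt : Tendsto (fun t => exp (2 * (t - s))) (𝓝[>] s) (𝓝 (exp (2 * (s - s)))) :=
      (Continuous.tendsto (by fun_prop) s).mono_left nhdsWithin_le_nhds
    have hlim : Tendsto (fun t => exp (2 * (t - s)) * K (A s) / (4 * π * Φ (A t))) (𝓝[>] s)
        (𝓝 (K (A s) / (4 * π * Φ (A s)))) := by
      have := (hEt.mul_const (K (A s))).div (hΦt.const_mul (4 * π)) (by positivity)
      simpa [Pi.div_def] using this
    filter_upwards [h.eventually_abs_sub_le (hHd _ hAs) (half_pos hε),
      hlim.eventually_lt_const (lt_add_of_pos_right _ (half_pos hε)),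
      Ioo_mem_nhdsGT hs.2] with t ht1 ht2 hst
    have hmn := hmain s t (hs₀.trans_le hs.1) hst.1
    have hlow := h.le_exp_mul hmain hK hΦ0 hΦl hΦd (hs₀.trans_le (hs.1.trans hst.1.le)) hst.2.le
    have hW' := h.lower hst.1.le
    have hΦA := hΦpos _ (h.pos t hst.2)
    have het : exp (2 * t) = exp (2 * s) * exp (2 * (t - s)) := by
      rw [← exp_add]
      ring_nf
    have hD0 := sub_nonneg.mpr (h.antitone_right hst.1.le)
    rw [het] at hlow
    set E := exp (2 * (t - s)) with hE
    set D := A s - A t with hD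
    have hE0 : 0 < E := exp_pos _
    have hts : 0 < t - s := sub_pos.mpr hst.1
    have b1 : exp (2 * s) * (4 * π * (t - s) * V t) ≤ D * K (A s) :=
      (mul_le_mul_of_nonneg_left hmn (exp_pos _).le).trans (by
        rw [← mul_assoc]
        exact mul_le_mul_of_nonneg_right hW' (hK _ hAs))
    have b2 : t - s ≤ D * (E * K (A s) / (4 * π * Φ (A t))) := by
      rw [← mul_div_assoc, le_div_iff₀ (by positivity)]
      calc (t - s) * (4 * π * Φ (A t)) ≤ (t - s) * (4 * π * (exp (2 * s) * E * V t)) := by gcongr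
        _ = E * (exp (2 * s) * (4 * π * (t - s) * V t)) := by ring
        _ ≤ E * (D * K (A s)) := by gcongr
        _ = D * (E * K (A s)) := by ring
    have b3 := mul_le_mul_of_nonneg_left ht2.le hD0
    have b4 := (abs_le.mp ht1).1
    have e3 : -A t - -A s = D := by rw [hD]; ring
    simp only [e3]
    linarith
  · intro t ht ε hε
    filter_upwards [Ioo_mem_nhdsLT (sub_lt_self t hε)] with s hs
    have := hH (A t) (A s) (h.nonneg' t) (h.antitone_right hs.2.le)
    linarith [hs.1]

end IsLevelAreaPair

/-! ### Explicit comparison functions -/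

/-- The bound for the curvature integral over a superlevel set of area `a`, divided by `2π`:
`c a^r` up to the threshold `m`, and the constant `σ` beyond. -/
noncomputable def curvatureBound (c r σ m a : ℝ) : ℝ := if a ≤ m then c * a ^ r else σ

/-- An explicit subsolution `Φ` with left derivative `1 - curvatureBound` and `Φ 0 = 0`. It drops at
the threshold, which only weakens the resulting bound. -/
noncomputable def areaLowerBound (c r σ m a : ℝ) : ℝ :=
  if a ≤ m then a - c * a ^ (r + 1) / (r + 1) else (1 - σ) * a

/-- An explicit function `H` with left derivative `curvatureBound / (2 * areaLowerBound)`. Its value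
just beyond the threshold is raised to `|log (1 - σ)| / 2`. -/
noncomputable def heightBound (c r σ m a : ℝ) : ℝ :=
  if a ≤ m then -((1 + r) / (2 * r)) * log (1 - c * a ^ r / (1 + r))
  else 1 / 2 * |log (1 - σ)| + σ / (2 * (1 - σ)) * log (a / m)

section Comparison

variable {c r σ m : ℝ}

theorem mul_rpow_le_of_le (hc : 0 < c) (hr : 0 < r) (hcm : c * m ^ r ≤ r * σ) {a : ℝ}
    (ha : 0 ≤ a) (ham : a ≤ m) : c * a ^ r ≤ r * σ := by
  have := rpow_le_rpow ha ham hr.le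
  exact (by gcongr : c * a ^ r ≤ c * m ^ r).trans hcm

theorem mul_rpow_div_lt_one (hc : 0 < c) (hr : 0 < r) (hσ : σ < 1) (hcm : c * m ^ r ≤ r * σ)
    {a : ℝ} (ha : 0 ≤ a) (ham : a ≤ m) : c * a ^ r / (1 + r) < 1 := by
  rw [div_lt_one (by linarith)]
  have := mul_rpow_le_of_le hc hr hcm ha ham
  nlinarith

theorem curvatureBound_nonneg (hc : 0 < c) (hσ0 : 0 < σ) {a : ℝ} (ha : 0 < a) :
    0 ≤ curvatureBound c r σ m a := by
  unfold curvatureBound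
  split_ifs <;> positivity

theorem curvatureBound_mono (hc : 0 < c) (hr : 0 < r) (hr1 : r ≤ 1) (hσ0 : 0 < σ)
    (hcm : c * m ^ r ≤ r * σ) {a' a : ℝ} (ha' : 0 ≤ a') (haa : a' ≤ a) :
    curvatureBound c r σ m a' ≤ curvatureBound c r σ m a := by
  unfold curvatureBound
  split_ifs with h1 h2 h2
  · have := rpow_le_rpow ha' haa hr.le
    gcongr
  · have := mul_rpow_le_of_le hc hr hcm ha' h1
    nlinarith
  · exact absurd (haa.trans h2) h1
  · exact le_rfl

theorem areaLowerBound_zero (hr : 0 < r) (hm : 0 < m) : areaLowerBound c r σ m 0 = 0 := by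
  simp [areaLowerBound, hm.le, zero_rpow (by linarith : r + 1 ≠ 0)]

theorem areaLowerBound_eq {a : ℝ} (ha : 0 < a) (ham : a ≤ m) :
    areaLowerBound c r σ m a = a * (1 - c * a ^ r / (1 + r)) := by
  rw [areaLowerBound, if_pos ham, rpow_add_one ha.ne', add_comm r 1]
  ring

theorem areaLowerBound_pos (hc : 0 < c) (hr : 0 < r) (hσ : σ < 1) (hcm : c * m ^ r ≤ r * σ)
    {a : ℝ} (ha : 0 < a) : 0 < areaLowerBound c r σ m a := by
  by_cases ham : a ≤ m
  · rw [areaLowerBound_eq ha ham]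
    exact mul_pos ha (sub_pos.mpr (mul_rpow_div_lt_one hc hr hσ hcm ha.le ham))
  · rw [areaLowerBound, if_neg ham]
    exact mul_pos (sub_pos.mpr hσ) ha

theorem areaLowerBound_sub_le (hc : 0 < c) (hr : 0 < r) (hσ0 : 0 < σ)
    (hcm : c * m ^ r ≤ r * σ) {a' a : ℝ} (ha' : 0 ≤ a') (haa : a' ≤ a) :
    areaLowerBound c r σ m a - areaLowerBound c r σ m a' ≤ a - a' := by
  unfold areaLowerBound
  split_ifs with h1 h2 h2
  · have := rpow_le_rpow ha' haa (by linarith : 0 ≤ r + 1)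
    have : c * a' ^ (r + 1) / (r + 1) ≤ c * a ^ (r + 1) / (r + 1) := by gcongr
    linarith
  · exact absurd (haa.trans h1) h2
  · have hcp := mul_rpow_le_of_le hc hr hcm ha' h2
    have e : c * a' ^ (r + 1) = c * a' ^ r * a' := by
      rw [rpow_add_one' ha' (by linarith), mul_assoc]
    have : c * a' ^ (r + 1) / (r + 1) ≤ σ * a := by
      rw [e, div_le_iff₀ (by linarith)]
      calc c * a' ^ r * a' ≤ r * σ * a := by gcongr
        _ ≤ σ * a * (r + 1) := by nlinarith [mul_nonneg hσ0.le (ha'.trans haa)]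
    linarith
  · nlinarith

theorem hasDerivWithinAt_areaLowerBound (hr : 0 < r) {a : ℝ} (ha : 0 < a) :
    HasDerivWithinAt (areaLowerBound c r σ m) (1 - curvatureBound c r σ m a) (Iic a) a := by
  by_cases ham : a ≤ m
  · have hd : HasDerivAt (fun x : ℝ => x - c * x ^ (r + 1) / (r + 1))
        (1 - c * ((r + 1) * a ^ (r + 1 - 1)) / (r + 1)) a :=
      (hasDerivAt_id a).sub (((hasDerivAt_rpow_const (Or.inl ha.ne')).const_mul c).div_const _)
    have e : 1 - curvatureBound c r σ m a = 1 - c * ((r + 1) * a ^ (r + 1 - 1)) / (r + 1) := by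
      rw [curvatureBound, if_pos ham, add_sub_cancel_right]
      field_simp
    rw [e]
    exact hd.hasDerivWithinAt.congr (fun x hx => if_pos (le_trans hx ham)) (if_pos ham)
  · have hd : HasDerivAt (fun x : ℝ => (1 - σ) * x) (1 - σ) a := by
      simpa using (hasDerivAt_id a).const_mul (1 - σ)
    rw [curvatureBound, if_neg ham]
    refine (hd.congr_of_eventuallyEq ?_).hasDerivWithinAt
    filter_upwards [Ioi_mem_nhds (not_le.mp ham)] with x hx
    exact if_neg (not_le.mpr hx)

/-- Bernoulli's inequality bounds the height below the threshold. -/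
theorem heightBound_le_of_le (hc : 0 < c) (hr : 0 < r) (hσ0 : 0 < σ) (hσ : σ < 1)
    (hcm : c * m ^ r ≤ r * σ) {a : ℝ} (ha : 0 ≤ a) (ham : a ≤ m) :
    heightBound c r σ m a ≤ 1 / 2 * |log (1 - σ)| := by
  have hy := mul_rpow_le_of_le hc hr hcm ha ham
  have hpos := sub_pos.mpr (mul_rpow_div_lt_one hc hr hσ hcm ha ham)
  rw [heightBound, if_pos ham, abs_of_nonpos (log_nonpos (by linarith) (by linarith))]
  set y := c * a ^ r
  have hb := one_add_mul_self_le_rpow_one_add (s := -(y / (1 + r))) (by linarith)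
    (p := (1 + r) / r) (by rw [le_div_iff₀ hr]; linarith)
  have h1 : 1 - σ ≤ (1 - y / (1 + r)) ^ ((1 + r) / r) := by
    refine le_trans ?_ hb
    have e : (1 + r) / r * -(y / (1 + r)) = -(y / r) := by field_simp
    rw [e]
    have : y / r ≤ σ := by
      rw [div_le_iff₀ hr]
      linarith
    linarith
  have h2 := log_le_log (by linarith) h1
  rw [log_rpow hpos] at h2
  have e : (1 + r) / (2 * r) * log (1 - y / (1 + r)) =
      1 / 2 * ((1 + r) / r * log (1 - y / (1 + r))) := by
    field_simp
  linarith

theorem heightBound_zero (hr : 0 < r) (hm : 0 < m) : heightBound c r σ m 0 = 0 := by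
  simp [heightBound, hm.le, zero_rpow hr.ne']

theorem heightBound_mono (hc : 0 < c) (hr : 0 < r) (hσ0 : 0 < σ) (hσ : σ < 1) (hm : 0 < m)
    (hcm : c * m ^ r ≤ r * σ) {a' a : ℝ} (ha' : 0 ≤ a') (haa : a' ≤ a) :
    heightBound c r σ m a' ≤ heightBound c r σ m a := by
  have hs : 0 < σ / (2 * (1 - σ)) := div_pos hσ0 (by linarith)
  by_cases h1 : a ≤ m
  · rw [heightBound, heightBound, if_pos h1, if_pos (haa.trans h1)]
    have hpos := sub_pos.mpr (mul_rpow_div_lt_one hc hr hσ hcm (ha'.trans haa) h1)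
    have h2 := rpow_le_rpow ha' haa hr.le
    have h3 : c * a' ^ r / (1 + r) ≤ c * a ^ r / (1 + r) := by gcongr
    have h4 := log_le_log hpos (by linarith : _ ≤ 1 - c * a' ^ r / (1 + r))
    have h5 : 0 < (1 + r) / (2 * r) := by positivity
    nlinarith
  · by_cases h2 : a' ≤ m
    · refine (heightBound_le_of_le hc hr hσ0 hσ hcm ha' h2).trans ?_
      rw [heightBound, if_neg h1]
      have : 0 ≤ log (a / m) := log_nonneg (by rw [le_div_iff₀ hm]; linarith)
      have := mul_nonneg hs.le this
      linarith
    · rw [heightBound, heightBound, if_neg h1, if_neg h2]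
      have h3 : 0 < a' / m := div_pos (hm.trans (not_le.mp h2)) hm
      have h4 : log (a' / m) ≤ log (a / m) := log_le_log h3 (by gcongr)
      gcongr

theorem heightBound_le (hc : 0 < c) (hr : 0 < r) (hσ0 : 0 < σ) (hσ : σ < 1) (hm : 0 < m)
    (hcm : c * m ^ r ≤ r * σ) {a : ℝ} (ham : m ≤ a) :
    heightBound c r σ m a ≤ 1 / 2 * |log (1 - σ)| + σ / (2 * (1 - σ)) * log (a / m) := by
  rcases ham.eq_or_lt with rfl | h
  · have := heightBound_le_of_le hc hr hσ0 hσ hcm hm.le le_rfl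
    rwa [div_self hm.ne', log_one, mul_zero, add_zero]
  · rw [heightBound, if_neg (not_le.mpr h)]

theorem hasDerivWithinAt_heightBound (hc : 0 < c) (hr : 0 < r) (hσ : σ < 1) (hm : 0 < m)
    (hcm : c * m ^ r ≤ r * σ) {a : ℝ} (ha : 0 < a) :
    HasDerivWithinAt (heightBound c r σ m)
      (curvatureBound c r σ m a / (2 * areaLowerBound c r σ m a)) (Iic a) a := by
  by_cases ham : a ≤ m
  · have hpos := sub_pos.mpr (mul_rpow_div_lt_one hc hr hσ hcm ha.le ham)
    have hd : HasDerivAt (fun x : ℝ => -((1 + r) / (2 * r)) * log (1 - c * x ^ r / (1 + r)))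
        (-((1 + r) / (2 * r)) * (-(c * (r * a ^ (r - 1)) / (1 + r)) / (1 - c * a ^ r / (1 + r))))
        a :=
      (((((hasDerivAt_rpow_const (Or.inl ha.ne')).const_mul c).div_const _).const_sub 1).log
        hpos.ne').const_mul _
    have e : curvatureBound c r σ m a / (2 * areaLowerBound c r σ m a) =
        -((1 + r) / (2 * r)) *
          (-(c * (r * a ^ (r - 1)) / (1 + r)) / (1 - c * a ^ r / (1 + r))) := by
      rw [curvatureBound, if_pos ham, areaLowerBound_eq ha ham, rpow_sub_one ha.ne']
      have h1 : 1 + r ≠ 0 := by linarith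
      generalize 1 - c * a ^ r / (1 + r) = q at hpos ⊢
      field_simp
    rw [e]
    exact hd.hasDerivWithinAt.congr (fun x hx => if_pos (le_trans hx ham)) (if_pos ham)
  · have hd : HasDerivAt
        (fun x : ℝ => 1 / 2 * |log (1 - σ)| + σ / (2 * (1 - σ)) * log (x / m))
        (σ / (2 * (1 - σ)) * (1 / m / (a / m))) a :=
      ((((hasDerivAt_id a).div_const m).log (div_pos ha hm).ne').const_mul _).const_add _
    have e : curvatureBound c r σ m a / (2 * areaLowerBound c r σ m a) =
        σ / (2 * (1 - σ)) * (1 / m / (a / m)) := by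
      rw [curvatureBound, if_neg ham, areaLowerBound, if_neg ham]
      have h1 : 1 - σ ≠ 0 := by linarith
      field_simp
    rw [e]
    refine (hd.congr_of_eventuallyEq ?_).hasDerivWithinAt
    filter_upwards [Ioi_mem_nhds (not_le.mp ham)] with x hx
    exact if_neg (not_le.mpr hx)

/-- The height estimate for a pair of area functions satisfying the level-set inequality. -/
theorem IsLevelAreaPair.sub_le_heightBound {V A : ℝ → ℝ} {M : ℝ} (h : IsLevelAreaPair V A M)
    (hc : 0 < c) (hr : 0 < r) (hσ0 : 0 < σ) (hσ : σ < 1) (hm : 0 < m) (hcm : c * m ^ r ≤ r * σ)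
    (hmain : ∀ s t, 0 < s → s < t →
      4 * π * (t - s) * V t ≤ (V s - V t) * (2 * π * curvatureBound c r σ m (A s)))
    {s : ℝ} (hs : 0 < s) (hsM : s ≤ M) : M - s ≤ heightBound c r σ m (A s) := by
  have hK : ∀ a, 0 < a → 0 ≤ 2 * π * curvatureBound c r σ m a := fun a ha =>
    mul_nonneg (by positivity) (curvatureBound_nonneg hc hσ0 ha)
  have := h.sub_le_of_hasDerivWithinAt (K := fun a => 2 * π * curvatureBound c r σ m a) hmain hK
    (areaLowerBound_zero (c := c) (σ := σ) hr hm)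
    (fun a ha => areaLowerBound_pos hc hr hσ hcm ha)
    (fun a' a ha' haa => areaLowerBound_sub_le hc hr hσ0 hcm ha' haa)
    (fun a ha => by
      rw [mul_div_cancel_left₀ _ (by positivity)]
      exact hasDerivWithinAt_areaLowerBound hr ha)
    (fun a' a ha' haa => heightBound_mono hc hr hσ0 hσ hm hcm ha' haa)
    (fun a ha => by
      have e : 2 * π * curvatureBound c r σ m a / (4 * π * areaLowerBound c r σ m a) =
          curvatureBound c r σ m a / (2 * areaLowerBound c r σ m a) := by
        rw [show 4 * π * areaLowerBound c r σ m a = 2 * π * (2 * areaLowerBound c r σ m a) by ring,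
          mul_div_mul_left _ _ (by positivity)]
      rw [e]
      exact hasDerivWithinAt_heightBound hc hr hσ hm hcm ha) hs hsM
  rwa [heightBound_zero hr hm, sub_zero] at this

end Comparison

/-! ### Conformal metrics and superlevel sets -/

namespace MetricField

theorem conformal_apply (u : Plane → ℝ) (x : Plane) (i j : Fin 2) :
    conformal u x i j = exp (2 * u x) * if i = j then 1 else 0 := by
  simp [conformal, Matrix.one_apply]

theorem det_conformal (u : Plane → ℝ) (x : Plane) : (conformal u x).det = exp (2 * u x) ^ 2 := by
  simp [conformal]

theorem sqrt_det_conformal (u : Plane → ℝ) (x : Plane) :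
    √(conformal u x).det = exp (2 * u x) := by
  rw [det_conformal, sqrt_sq (exp_pos _).le]

theorem conformal_inv_apply (u : Plane → ℝ) (x : Plane) (i j : Fin 2) :
    (conformal u x)⁻¹ i j = (exp (2 * u x))⁻¹ * if i = j then 1 else 0 := by
  have : (conformal u x)⁻¹ = (exp (2 * u x))⁻¹ • (1 : Matrix (Fin 2) (Fin 2) ℝ) := by
    refine Matrix.inv_eq_right_inv ?_
    rw [conformal, Matrix.smul_mul, Matrix.mul_smul, smul_smul,
      mul_inv_cancel₀ (exp_pos _).ne', one_smul, one_mul]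
  rw [this]
  simp [Matrix.one_apply]

theorem partialDeriv_conformal {u : Plane → ℝ} {x : Plane} (hu : DifferentiableAt ℝ u x)
    (i j l : Fin 2) : partialDeriv i (fun y => conformal u y j l) x =
      2 * exp (2 * u x) * partialDeriv i u x * if j = l then 1 else 0 := by
  have h : HasFDerivAt (fun y => conformal u y j l)
      ((if j = l then (1 : ℝ) else 0) • (exp (2 * u x) • ((2 : ℝ) • fderiv ℝ u x))) x := by
    simp only [conformal_apply]
    exact ((hu.hasFDerivAt.const_mul 2).exp).mul_const _
  rw [partialDeriv, h.fderiv]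
  simp only [smul_apply, smul_eq_mul, partialDeriv]
  ring

theorem christoffel_conformal {u : Plane → ℝ} {x : Plane} (hu : DifferentiableAt ℝ u x)
    (k i j : Fin 2) : (conformal u).christoffel k i j x =
      (if j = k then partialDeriv i u x else 0) + (if i = k then partialDeriv j u x else 0) -
        if i = j then partialDeriv k u x else 0 := by
  have hE := (exp_pos (2 * u x)).ne'
  simp only [christoffel, partialDeriv_conformal hu, conformal_inv_apply, mul_ite, mul_one,
    mul_zero, ite_mul, zero_mul, Finset.sum_ite_eq, Finset.mem_univ, if_true]
  split_ifs <;> field_simp <;> ring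

theorem partialDeriv_congr {f f' : Plane → ℝ} {x : Plane} (h : f =ᶠ[𝓝 x] f') (i : Fin 2) :
    partialDeriv i f x = partialDeriv i f' x := by
  rw [partialDeriv, partialDeriv, h.fderiv_eq]

/-- The curvature equation `K dA = -Δu dx` of the metric `e^{2u} g₀`. -/
theorem gaussCurvature_conformal_mul {u : Plane → ℝ} {x : Plane}
    (hu : ∀ᶠ y in 𝓝 x, DifferentiableAt ℝ u y) :
    (conformal u).gaussCurvature x * √(conformal u x).det = -flatLaplacian u x := by
  have e1 : partialDeriv 0 ((conformal u).christoffel 0 1 1) x =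
      -partialDeriv 0 (partialDeriv 0 u) x := by
    have : (conformal u).christoffel 0 1 1 =ᶠ[𝓝 x] fun y => -partialDeriv 0 u y := by
      filter_upwards [hu] with y hy
      simp [christoffel_conformal hy]
    rw [partialDeriv_congr this, partialDeriv, fderiv_fun_neg]
    rfl
  have e2 : partialDeriv 1 ((conformal u).christoffel 0 0 1) x =
      partialDeriv 1 (partialDeriv 1 u) x := by
    refine partialDeriv_congr ?_ _
    filter_upwards [hu] with y hy
    simp [christoffel_conformal hy]
  have hR : (conformal u).riemannTensor 0 1 0 1 x = -flatLaplacian u x := by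
    rw [riemannTensor, e1, e2, flatLaplacian]
    simp only [Fin.sum_univ_two, christoffel_conformal hu.self_of_nhds]
    simp
    ring
  rw [gaussCurvature, sqrt_det_conformal, det_conformal]
  simp only [conformal_apply, Fin.sum_univ_two, hR]
  have hE := (exp_pos (2 * u x)).ne'
  simp
  field_simp

end MetricField

theorem flatLaplacian_congr {f f' : Plane → ℝ} {x : Plane} (h : f =ᶠ[𝓝 x] f') :
    flatLaplacian f x = flatLaplacian f' x := by
  refine Finset.sum_congr rfl fun i _ => MetricField.partialDeriv_congr ?_ i
  exact h.eventuallyEq_nhds.mono fun y hy => MetricField.partialDeriv_congr hy i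

/-- A smooth nonnegative function on an open set can be cut off outside a given compact set to a
smooth function of compact support on the plane. -/
theorem exists_contDiff_cutoff {G K : Set Plane} (hG : IsOpen G) (hK : IsCompact K) (hKG : K ⊆ G)
    {u : Plane → ℝ} (hu : ContDiffOn ℝ ∞ u G) (hu0 : ∀ x ∈ G, 0 ≤ u x) :
    ∃ U : Plane → ℝ, ContDiff ℝ ∞ U ∧ HasCompactSupport U ∧ (∀ x ∈ K, U x = u x) ∧
      (∀ x ∈ G, U x ≤ u x) ∧ ∀ x, x ∉ G → U x = 0 := by
  obtain ⟨δ, hδ, hδG⟩ := hK.exists_cthickening_subset_open hG hKG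
  obtain ⟨ρ, hρ, hρr, hρs, hρ1⟩ := exists_contMDiff_support_eq_eq_one_iff
    (modelWithCornersSelf ℝ Plane) (n := ⊤) (Metric.isOpen_thickening (δ := δ) (E := K))
    hK.isClosed (Metric.self_subset_thickening hδ K)
  have hts : tsupport ρ ⊆ Metric.cthickening δ K := by
    rw [tsupport, hρs]
    exact Metric.closure_thickening_subset_cthickening δ K
  have hρc : HasCompactSupport ρ := hK.cthickening.of_isClosed_subset (isClosed_tsupport ρ) hts
  refine ⟨fun x => ρ x * u x, ?_, hρc.mul_right, fun x hx => ?_, fun x hx => ?_, fun x hx => ?_⟩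
  · rw [contDiff_iff_contDiffAt]
    intro x
    by_cases hx : x ∈ tsupport ρ
    · exact hρ.contDiff.contDiffAt.mul (hu.contDiffAt (hG.mem_nhds (hδG (hts hx))))
    · refine contDiffAt_const (c := (0 : ℝ)) |>.congr_of_eventuallyEq ?_
      filter_upwards [(isClosed_tsupport ρ).isOpen_compl.mem_nhds hx] with y hy
      rw [image_eq_zero_of_notMem_tsupport hy, zero_mul]
  · simp only [(hρ1 x).mp hx, one_mul]
  · exact mul_le_of_le_one_left (hu0 x hx) (hρr (mem_range_self x)).2
  · have : x ∉ tsupport ρ := fun h => hx (hδG (hts h))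
    simp only [image_eq_zero_of_notMem_tsupport this, zero_mul]

section Superlevel

/-- The superlevel set `{u > t}` within `G`. -/
def superlevel (G : Set Plane) (u : Plane → ℝ) (t : ℝ) : Set Plane := {x ∈ G | t < u x}

variable {G : Set Plane} {u : Plane → ℝ}

theorem superlevel_antitone : Antitone (superlevel G u) :=
  fun _ _ hst _ hx => ⟨hx.1, lt_of_le_of_lt hst hx.2⟩

theorem superlevel_subset (t : ℝ) : superlevel G u t ⊆ G := fun _ hx => hx.1

theorem isOpen_superlevel (hG : IsOpen G) (hu : ContinuousOn u G) (t : ℝ) :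
    IsOpen (superlevel G u t) :=
  hu.isOpen_inter_preimage hG isOpen_Ioi

theorem tendsto_volume_real_superlevel (hG : IsOpen G) (hb : Bornology.IsBounded G)
    (hu : ContinuousOn u G) (s : ℝ) :
    Tendsto (fun t => volume.real (superlevel G u t)) (𝓝[>] s)
      (𝓝 (volume.real (superlevel G u s))) := by
  refine (ENNReal.tendsto_toReal
    ((measure_mono (superlevel_subset s)).trans_lt hb.measure_lt_top).ne).comp ?_
  refine tendsto_measure_of_tendsto_indicator (𝓝[>] s)
    (fun t => (isOpen_superlevel hG hu t).measurableSet) hG.measurableSet hb.measure_lt_top.ne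
    (Eventually.of_forall fun t => superlevel_subset t) fun x => ?_
  by_cases hx : x ∈ superlevel G u s
  · filter_upwards [Ioo_mem_nhdsGT hx.2] with t ht
    exact ⟨fun _ => hx, fun _ => ⟨hx.1, ht.2⟩⟩
  · filter_upwards [self_mem_nhdsWithin] with t ht
    exact ⟨fun h => absurd (superlevel_antitone (le_of_lt ht) h) hx, fun h => absurd h hx⟩

/-- The level-set inequality on `G`, with the flux expressed by the curvature. -/
theorem four_pi_mul_volume_superlevel_le (hG : IsOpen G) (hb : Bornology.IsBounded G)
    (hu : ContDiffOn ℝ ∞ u (closure G)) (hu0 : ∀ x ∈ closure G, 0 ≤ u x)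
    (hf : ∀ x ∈ frontier G, u x = 0) {s t k : ℝ} (hs : 0 < s) (hst : s < t)
    (hk : ∀ τ ∈ Ioo s t, (MetricField.conformal u).curvatureIntegral (superlevel G u τ) ≤ k) :
    4 * π * (t - s) * volume.real (superlevel G u t) ≤
      (volume.real (superlevel G u s) - volume.real (superlevel G u t)) * k := by
  have huG : ContDiffOn ℝ ∞ u G := hu.mono subset_closure
  have hcG : ContinuousOn u G := huG.continuousOn
  have hKc : IsCompact (closure G ∩ u ⁻¹' Ici s) :=
    hb.isCompact_closure.of_isClosed_subset
      (hu.continuousOn.preimage_isClosed_of_isClosed isClosed_closure isClosed_Ici) inter_subset_left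
  have hKG : closure G ∩ u ⁻¹' Ici s ⊆ G := by
    rintro x ⟨hx, hxs⟩
    by_contra hxG
    have : x ∈ frontier G := by rw [hG.frontier_eq]; exact ⟨hx, hxG⟩
    rw [mem_preimage, hf x this] at hxs
    exact absurd hs (not_lt.mpr hxs)
  obtain ⟨U, hU, hUc, hUK, hUG, hUn⟩ := exists_contDiff_cutoff hG hKc hKG huG
    fun x hx => hu0 x (subset_closure hx)
  have hlev : ∀ τ, s ≤ τ → {x | τ < U x} = superlevel G u τ := by
    intro τ hτ
    ext x
    refine ⟨fun hx => ?_, fun hx => ?_⟩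
    · have hx' : τ < U x := hx
      have hxG : x ∈ G := by
        by_contra h
        rw [hUn x h] at hx'
        linarith
      exact ⟨hxG, hx'.trans_le (hUG x hxG)⟩
    · change τ < U x
      rw [hUK x ⟨subset_closure hx.1, hτ.trans hx.2.le⟩]
      exact hx.2
  have h := four_pi_mul_sub_mul_le hU hUc hs hst (k := k) fun τ hτ => by
    rw [hlev τ hτ.1.le]
    refine le_trans (le_of_eq ?_) (hk τ hτ)
    refine setIntegral_congr_fun (isOpen_superlevel hG hcG τ).measurableSet fun x hx => ?_
    have hUu : U =ᶠ[𝓝 x] u := by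
      filter_upwards [(isOpen_superlevel hG hcG τ).mem_nhds hx] with y hy
      exact hUK y ⟨subset_closure hy.1, hτ.1.le.trans hy.2.le⟩
    have hd : ∀ᶠ y in 𝓝 x, DifferentiableAt ℝ u y := by
      filter_upwards [hG.mem_nhds hx.1] with y hy
      exact (huG.contDiffAt (hG.mem_nhds hy)).differentiableAt (by simp)
    simp only [MetricField.gaussCurvature_conformal_mul hd, flatLaplacian_congr hUu]
  rwa [hlev s le_rfl, hlev t hst.le] at h

theorem integrableOn_exp_two_mul (hb : Bornology.IsBounded G) (hu : ContinuousOn u (closure G)) :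
    IntegrableOn (fun x => exp (2 * u x)) G :=
  ((continuous_exp.comp_continuousOn (hu.const_smul (2 : ℝ))).integrableOn_compact
    hb.isCompact_closure).mono_set subset_closure

theorem area_conformal (S : Set Plane) :
    (MetricField.conformal u).area S = ∫ x in S, exp (2 * u x) := by
  simp only [MetricField.area, MetricField.sqrt_det_conformal]

theorem area_superlevel_le (hb : Bornology.IsBounded G) (hu : ContinuousOn u (closure G)) (t : ℝ) :
    (MetricField.conformal u).area (superlevel G u t) ≤ (MetricField.conformal u).area G := by
  rw [area_conformal, area_conformal]
  exact setIntegral_mono_set (integrableOn_exp_two_mul hb hu)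
    (ae_of_all _ fun x => (exp_pos _).le) (superlevel_subset t).eventuallyLE

theorem isLevelAreaPair_superlevel (hG : IsOpen G) (hb : Bornology.IsBounded G)
    (hu : ContinuousOn u (closure G)) {M : ℝ} (hM : ∀ x ∈ G, u x ≤ M) {x₀ : Plane} (hx₀ : x₀ ∈ G)
    (hx₀M : u x₀ = M) :
    IsLevelAreaPair (fun t => volume.real (superlevel G u t))
      (fun t => (MetricField.conformal u).area (superlevel G u t)) M := by
  have hcG : ContinuousOn u G := hu.mono subset_closure
  have hfin : ∀ t, volume (superlevel G u t) < ⊤ := fun t =>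
    (measure_mono (superlevel_subset t)).trans_lt hb.measure_lt_top
  have hms : ∀ t, MeasurableSet (superlevel G u t) := fun t =>
    (isOpen_superlevel hG hcG t).measurableSet
  have hint : ∀ t, IntegrableOn (fun x => exp (2 * u x)) (superlevel G u t) := fun t =>
    (integrableOn_exp_two_mul hb hu).mono_set (superlevel_subset t)
  have hdiff : ∀ s t, s ≤ t → (MetricField.conformal u).area (superlevel G u s) -
      (MetricField.conformal u).area (superlevel G u t) =
      ∫ x in superlevel G u s \ superlevel G u t, exp (2 * u x) := fun s t hst => by
    rw [area_conformal, area_conformal, setIntegral_sdiff (hms t) (hint s) (superlevel_antitone hst)]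
  have hvol : ∀ s t, s ≤ t → volume.real (superlevel G u s) - volume.real (superlevel G u t) =
      volume.real (superlevel G u s \ superlevel G u t) := fun s t hst =>
    (measureReal_sdiff (superlevel_antitone hst) (hms t) (hfin s).ne).symm
  have hdfin : ∀ s t, volume (superlevel G u s \ superlevel G u t) ≠ ⊤ := fun s t =>
    ((measure_mono sdiff_subset).trans_lt (hfin s)).ne
  have hlow : ∀ s t, s ≤ t → exp (2 * s) *
      (volume.real (superlevel G u s) - volume.real (superlevel G u t)) ≤
      (MetricField.conformal u).area (superlevel G u s) -
      (MetricField.conformal u).area (superlevel G u t) := by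
    intro s t hst
    rw [hvol s t hst, hdiff s t hst]
    refine setIntegral_ge_of_const_le_real ((hms s).diff (hms t)) (hdfin s t) (fun x hx => ?_)
      ((hint s).mono_set sdiff_subset)
    exact exp_le_exp.mpr (by linarith [hx.1.2])
  have hzero : superlevel G u M = ∅ :=
    eq_empty_of_forall_notMem fun x hx => (hM x hx.1).not_gt hx.2
  refine ⟨fun s t hst => measureReal_mono (superlevel_antitone hst) (hfin s).ne,
    fun t => measureReal_nonneg, fun t => ?_, hlow, fun s t hst => ?_,
    tendsto_volume_real_superlevel hG hb hcG, ?_, ?_, fun s hs => ?_⟩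
  · rw [area_conformal]
    exact integral_nonneg fun x => (exp_pos _).le
  · rw [hvol s t hst, hdiff s t hst]
    have h : ∫ x in superlevel G u s \ superlevel G u t, exp (2 * u x) ≤
        ∫ x in superlevel G u s \ superlevel G u t, exp (2 * t) := by
      refine setIntegral_mono_on ((hint s).mono_set sdiff_subset) (integrableOn_const (hdfin s t))
        ((hms s).diff (hms t)) fun x hx => ?_
      refine exp_le_exp.mpr ?_
      have : ¬ t < u x := fun h => hx.2 ⟨hx.1.1, h⟩
      linarith
    rwa [setIntegral_const, smul_eq_mul, mul_comm] at h
  · simp [hzero]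
  · simp [hzero, area_conformal]
  · have h := hlow s M hs.le
    have hpos := (isOpen_superlevel hG hcG s).measure_pos volume ⟨x₀, hx₀, hs.trans_eq hx₀M.symm⟩
    have hpos' : 0 < volume.real (superlevel G u s) := ENNReal.toReal_pos hpos.ne' (hfin s).ne
    simp only [hzero, measureReal_empty, area_conformal, setIntegral_empty, sub_zero] at h
    rw [area_conformal]
    exact lt_of_lt_of_le (mul_pos (exp_pos _) hpos') h

end Superlevel

/-! ### The height estimate -/

theorem MetricField.curvatureIntegral_le_of_supCurvatureIntegral_le {g : MetricField}
    {G S : Set Plane} (hS : IsOpen S) (hSG : S ⊆ G) {k : ℝ}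
    (h : g.supCurvatureIntegral G (g.area S) ≤ (k : EReal)) : g.curvatureIntegral S ≤ k := by
  have hmem : ((g.curvatureIntegral S : ℝ) : EReal) ≤ g.supCurvatureIntegral G (g.area S) :=
    le_sSup ⟨S, hS, hSG, rfl, rfl⟩
  exact EReal.coe_le_coe_iff.mp (hmem.trans h)

theorem mainTheorem7 (G : Set Plane) (hGo : IsOpen G) (hGb : Bornology.IsBounded G)
    (u : Plane → ℝ) (hu : ContDiffOn ℝ ∞ u (closure G))
    (hu_nonneg : ∀ x ∈ closure G, 0 ≤ u x) (hu_bdry : ∀ x ∈ frontier G, u x = 0)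
    (g : MetricField) (hg : g = MetricField.conformal u)
    (μ₀ : ℝ) (hμ₀ : μ₀ = g.area G)
    (κ : ℝ) (hκ : κ ∈ Set.Ioo 0 (2 * π)) (C : ℝ) (hC : 0 < C)
    (r : ℝ) (hr : r ∈ Set.Ioc (0 : ℝ) 1) (μ₁ : ℝ) (hμ₁ : μ₁ ∈ Set.Ioc 0 μ₀)
    (hk_small : ∀ A : ℝ, 0 ≤ A → A ≤ μ₁ →
      g.supCurvatureIntegral G A ≤ ((C * A ^ r : ℝ) : EReal) ∧ C * A ^ r ≤ κ)
    (hk_large : ∀ A : ℝ, μ₁ ≤ A → A ≤ μ₀ → g.supCurvatureIntegral G A ≤ (κ : EReal)) :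
    ∃ M : ℝ, IsGreatest (u '' closure G) M ∧
      M ≤ 1 / 2 * |Real.log (1 - κ / (2 * π))| +
        κ / (4 * π - 2 * κ) * Real.log (μ₀ / (r ^ (1 / r) * μ₁)) := by
  subst hg hμ₀
  obtain ⟨hr0, hr1⟩ := hr
  obtain ⟨hκ0, hκ2⟩ := hκ
  obtain ⟨hμ₁0, hμ₁₀⟩ := hμ₁
  have hpi : 0 < 2 * π := by positivity
  have hne : G.Nonempty := by
    rw [nonempty_iff_ne_empty]
    rintro rfl
    rw [area_conformal, setIntegral_empty] at hμ₁₀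
    linarith
  obtain ⟨x₀, hx₀, hmax⟩ := hGb.isCompact_closure.exists_isMaxOn hne.closure hu.continuousOn
  refine ⟨u x₀, ⟨mem_image_of_mem u hx₀, ?_⟩, ?_⟩
  · rintro _ ⟨x, hx, rfl⟩
    exact hmax hx
  -- the area at which `C A ^ r` reaches `r κ`
  set m := r ^ (1 / r) * μ₁ with hm_def
  have hrr : 0 < r ^ (1 / r) := rpow_pos_of_pos hr0 _
  have hm : 0 < m := mul_pos hrr hμ₁0
  have hmμ : m ≤ μ₁ :=
    mul_le_of_le_one_left hμ₁0.le (rpow_le_one hr0.le hr1 (by positivity))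
  have hσ0 : 0 < κ / (2 * π) := div_pos hκ0 hpi
  have hσ1 : κ / (2 * π) < 1 := (div_lt_one hpi).mpr hκ2
  have hc : 0 < C / (2 * π) := div_pos hC hpi
  have hcm : C / (2 * π) * m ^ r ≤ r * (κ / (2 * π)) := by
    have h1 : m ^ r = r * μ₁ ^ r := by
      rw [hm_def, mul_rpow hrr.le hμ₁0.le, ← rpow_mul hr0.le, one_div_mul_cancel hr0.ne', rpow_one]
    have h2 := (hk_small μ₁ hμ₁0.le le_rfl).2
    rw [h1, show C / (2 * π) * (r * μ₁ ^ r) = r * (C * μ₁ ^ r / (2 * π)) by ring]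
    gcongr
  have hcoef : κ / (2 * π) / (2 * (1 - κ / (2 * π))) = κ / (4 * π - 2 * κ) := by
    have h1 : 4 * π - 2 * κ ≠ 0 := by linarith
    have h2 : 2 * (1 - κ / (2 * π)) ≠ 0 := by linarith
    rw [div_eq_div_iff h2 h1]
    field_simp
    ring
  have hR := heightBound_le hc hr0 hσ0 hσ1 hm hcm (hmμ.trans hμ₁₀)
  rw [hcoef] at hR
  refine le_trans ?_ hR
  have hH0 : 0 ≤ heightBound (C / (2 * π)) r (κ / (2 * π)) m ((MetricField.conformal u).area G) := by
    have := heightBound_mono hc hr0 hσ0 hσ1 hm hcm le_rfl (hμ₁0.le.trans hμ₁₀)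
    rwa [heightBound_zero hr0 hm] at this
  rcases (hu_nonneg x₀ hx₀).eq_or_lt with h0 | hMpos
  · rwa [← h0]
  have hx₀G : x₀ ∈ G := by
    by_contra h
    have : x₀ ∈ frontier G := by rw [hGo.frontier_eq]; exact ⟨hx₀, h⟩
    exact hMpos.ne' (hu_bdry x₀ this)
  have hcG : ContinuousOn u G := hu.continuousOn.mono subset_closure
  have hpair := isLevelAreaPair_superlevel hGo hGb hu.continuousOn
    (fun x hx => hmax (subset_closure hx)) hx₀G rfl
  have hcurv : ∀ τ, (MetricField.conformal u).curvatureIntegral (superlevel G u τ) ≤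
      2 * π * curvatureBound (C / (2 * π)) r (κ / (2 * π)) m
        ((MetricField.conformal u).area (superlevel G u τ)) := by
    intro τ
    refine MetricField.curvatureIntegral_le_of_supCurvatureIntegral_le
      (isOpen_superlevel hGo hcG τ) (superlevel_subset τ) ?_
    have ha0 := hpair.nonneg' τ
    have ha1 := area_superlevel_le hGb hu.continuousOn τ
    generalize (MetricField.conformal u).area (superlevel G u τ) = a at ha0 ha1
    rw [curvatureBound]
    split_ifs with h
    · rw [← mul_assoc, mul_div_cancel₀ _ hpi.ne']
      exact (hk_small a ha0 (h.trans hmμ)).1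
    · rw [mul_div_cancel₀ _ hpi.ne']
      rcases le_total a μ₁ with h1 | h1
      · exact (hk_small a ha0 h1).1.trans (EReal.coe_le_coe_iff.mpr (hk_small a ha0 h1).2)
      · exact hk_large a h1 ha1
  have hmain : ∀ s t, 0 < s → s < t → 4 * π * (t - s) * volume.real (superlevel G u t) ≤
      (volume.real (superlevel G u s) - volume.real (superlevel G u t)) *
        (2 * π * curvatureBound (C / (2 * π)) r (κ / (2 * π)) m
          ((MetricField.conformal u).area (superlevel G u s))) := by
    intro s t hs hst
    refine four_pi_mul_volume_superlevel_le hGo hGb hu hu_nonneg hu_bdry hs hst fun τ hτ => ?_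
    refine (hcurv τ).trans (mul_le_mul_of_nonneg_left ?_ hpi.le)
    exact curvatureBound_mono hc hr0 hr1 hσ0 hcm (hpair.nonneg' τ)
      (hpair.antitone_right hτ.1.le)
  -- the level-set inequality holds only at positive levels, so start at a small level and let it
  -- tend to `0`
  refine le_of_forall_pos_le_add fun ε hε => ?_
  have h1 := hpair.sub_le_heightBound hc hr0 hσ0 hσ1 hm hcm hmain (lt_min hε hMpos)
    (min_le_right _ _)
  have h2 := heightBound_mono hc hr0 hσ0 hσ1 hm hcm (hpair.nonneg' (min ε (u x₀)))
    (area_superlevel_le hGb hu.continuousOn (min ε (u x₀)))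
  have h3 := min_le_left ε (u x₀)
  linarith
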